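/- Let $n\ge 1$ and let $D\subset\mathbb{R}^n$ be a bounded domain (open, connected, non-empty) with boundary of class $C^{1,1}$. Let $d_D(x)=\mathrm{dist}(x,D)-\mathrm{dist}(x,\mathbb{R}^n\setminus D)$ be its oriented distance function, and for $t\in\mathbb{R}$, $\varepsilon>0$ put $D_t=\{x\in\mathbb{R}^n: d_D(x)<t\}$ and $\Gamma_\varepsilon=D_\varepsilon\setminus\overline{D_{-\varepsilon}}$. Let $S:\mathbb{R}\to\mathbb{R}$ be Lipschitz continuous with $S(t)=t/|t|$ for $|t|\ge 1$, $S'(t)>0$ for almost every $|t|<1$, and $S(-t)=-S(t)$ for all $t$; suppose also that there are $\zeta_1,\zeta_2,\alpha>0$ with $\zeta_1t^\alpha\le \tfrac12(1+S(t-1))\le\zeta_2t^\alpha$ for all $t\in(0,2)$. Put $\omega^\varepsilon(x)=\tfrac12\bigl(1+S(-d_D(x)/\varepsilon)\bigr)$. For $1\le p\le\infty$ let $W^{1,p}(D_\varepsilon;\omega^\varepsilon)$ be the space of functions $h:D_\varepsilon\to\mathbb{R}$ which, together with their weak gradient $\nabla h$, belong to $L^p$ on $D_\varepsilon$ with respect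 to the measure $\omega^\varepsilon\,dx$. For such $h$ let $$\|h\|_{W^{1,p}(\Gamma_\varepsilon;\omega^\varepsilon)}=\Bigl(\int_{\Gamma_\varepsilon}\bigl(|h|^p+|\nabla h|^p\bigr)\,\omega^\varepsilon\,dx\Bigr)^{1/p}\quad(p<\infty),$$ and let it be $\max\{\|h\|_{L^\infty(\Gamma_\varepsilon)},\|\nabla h\|_{L^\infty(\Gamma_\varepsilon)}\}$ for $p=\infty$. Let $1\le p\le\infty$ and $\varepsilon_0>0$. Then there is a constant $C>0$, depending only on $n,D,S,p,\varepsilon_0$, such that for every $0<\varepsilon\le\varepsilon_0$, every domain $\Omega\subset\mathbb{R}^n$ with $\overline D\subset\Omega$ and $D_\varepsilon\subset\Omega$, and every $h\in W^{1,p}(D_\varepsilon;\omega^\varepsilon)$, the functions $h\,\omega^\varepsilon$ (extended by $0$ outside $D_\varepsilon$) and $h$ are integrable on $\Omega$ and on $D$, respectively, and $$\Bigl|\int_\Omega h\,\omega^\varepsilon\,dx-\int_D h\,dx\Bigr|\le C\,\varepsilon^{2-\frac1p}\,\|h\|_{W^{1,p}(\Gamma_\varepsilon;\omega^\varepsilon)},$$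 where $1/p=0$ if $p=\infty$. -/

import Mathlib

open MeasureTheory Set
open scoped ENNReal NNReal ContDiff RealInnerProductSpace

namespace DiffuseDomain

/-- The boundary of `D` is of class `C^{1,1}`: near each boundary point, after a rigid motion, `D` is
the region strictly below the graph of a `C¹` function with Lipschitz gradient.
Here `ν` is the "vertical" direction, `⟪ν, x⟫` is the height of `x` and `x - ⟪ν, x⟫ • ν` is the
orthogonal projection of `x` onto the hyperplane `ν^⊥`; only the values of `γ` on `ν^⊥` matter. -/
def HasC11Boundary {n : ℕ} (D : Set (EuclideanSpace ℝ (Fin n))) : Prop :=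
  ∀ x₀ ∈ frontier D, ∃ (ν : EuclideanSpace ℝ (Fin n)) (r : ℝ)
    (γ : EuclideanSpace ℝ (Fin n) → ℝ) (K : ℝ≥0),
    ‖ν‖ = 1 ∧ 0 < r ∧ ContDiff ℝ 1 γ ∧ LipschitzWith K (fderiv ℝ γ) ∧
    ∀ x ∈ Metric.ball x₀ r, (x ∈ D ↔ ⟪ν, x⟫ < γ (x - ⟪ν, x⟫ • ν))

/-- The oriented distance function `d_D(x) = dist(x, D) - dist(x, ℝⁿ \ D)`. -/
noncomputable def orientedDist {n : ℕ} (D : Set (EuclideanSpace ℝ (Fin n)))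
    (x : EuclideanSpace ℝ (Fin n)) : ℝ :=
  Metric.infDist x D - Metric.infDist x Dᶜ

/-- The sublevel set `D_t = {d_D < t}`. -/
def sublevel {n : ℕ} (D : Set (EuclideanSpace ℝ (Fin n))) (t : ℝ) :
    Set (EuclideanSpace ℝ (Fin n)) :=
  {x | orientedDist D x < t}

/-- The tubular neighbourhood `Γ_ε = D_ε \ closure D_{-ε}` of the boundary of `D`. -/
def tube {n : ℕ} (D : Set (EuclideanSpace ℝ (Fin n))) (ε : ℝ) :
    Set (EuclideanSpace ℝ (Fin n)) :=
  sublevel D ε \ closure (sublevel D (-ε))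

/-- Admissible regularizations of the sign function: a Lipschitz function which is odd, equals the
sign function on `|t| ≥ 1`, has `S' > 0` on `|t| < 1` (almost everywhere, the derivative of a
Lipschitz function being defined only almost everywhere), and is such that `(1 + S (t - 1)) / 2` is
comparable to a power `t ^ α`, `α > 0`, on `(0, 2)`. -/
structure IsSigmoidal (S : ℝ → ℝ) : Prop where
  lipschitz : ∃ K : ℝ≥0, LipschitzWith K S
  eq_sign : ∀ t : ℝ, 1 ≤ |t| → S t = t / |t|
  deriv_pos : ∀ᵐ t : ℝ, |t| < 1 → DifferentiableAt ℝ S t ∧ 0 < deriv S t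
  odd : ∀ t : ℝ, S t = -S (-t)
  power : ∃ ζ₁ ζ₂ α : ℝ, 0 < ζ₁ ∧ 0 < ζ₂ ∧ 0 < α ∧ ∀ t ∈ Ioo (0 : ℝ) 2,
    ζ₁ * t ^ α ≤ (1 + S (t - 1)) / 2 ∧ (1 + S (t - 1)) / 2 ≤ ζ₂ * t ^ α

/-- The phase-field function `ω^ε = (1 + S(-d_D / ε)) / 2`. -/
noncomputable def phaseField {n : ℕ} (S : ℝ → ℝ) (D : Set (EuclideanSpace ℝ (Fin n))) (ε : ℝ)
    (x : EuclideanSpace ℝ (Fin n)) : ℝ :=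
  (1 + S (-orientedDist D x / ε)) / 2

/-- The measure `w dx` on `U`. -/
noncomputable def weightedMeasure {n : ℕ} (w : EuclideanSpace ℝ (Fin n) → ℝ)
    (U : Set (EuclideanSpace ℝ (Fin n))) : Measure (EuclideanSpace ℝ (Fin n)) :=
  (volume.restrict U).withDensity (fun x => ENNReal.ofReal (w x))

/-- `g` is the weak (distributional) gradient of `h` on the open set `U`. -/
structure IsWeakGradient {n : ℕ} (U : Set (EuclideanSpace ℝ (Fin n)))
    (h : EuclideanSpace ℝ (Fin n) → ℝ)
    (g : EuclideanSpace ℝ (Fin n) → EuclideanSpace ℝ (Fin n)) : Prop where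
  locallyIntegrable : LocallyIntegrableOn h U
  locallyIntegrable_grad : LocallyIntegrableOn g U
  integral_eq : ∀ φ : EuclideanSpace ℝ (Fin n) → ℝ,
    ContDiff ℝ ∞ φ → HasCompactSupport φ → tsupport φ ⊆ U → ∀ i : Fin n,
      ∫ x in U, h x * fderiv ℝ φ x (EuclideanSpace.single i 1) = -∫ x in U, g x i * φ x

/-- `h` belongs to the weighted Sobolev space `W^{1,p}(U; w)`, with weak gradient `g`. When `w > 0`
on `U`, the measure `w dx` has the null sets of Lebesgue measure on `U`, so that for `p = ∞` this is
the unweighted space `W^{1,∞}(U)`. -/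
structure MemWeightedSobolev {n : ℕ} (p : ℝ≥0∞) (U : Set (EuclideanSpace ℝ (Fin n)))
    (w : EuclideanSpace ℝ (Fin n) → ℝ) (h : EuclideanSpace ℝ (Fin n) → ℝ)
    (g : EuclideanSpace ℝ (Fin n) → EuclideanSpace ℝ (Fin n)) : Prop where
  memLp : MemLp h p (weightedMeasure w U)
  memLp_grad : MemLp g p (weightedMeasure w U)
  isWeakGradient : IsWeakGradient U h g

/-- The norm of `W^{1,p}(U; w)`, for a function `h` with weak gradient `g`:
`(∫_U |h|^p + |g|^p w dx)^{1/p}` for `p < ∞`, and the larger of the two essential suprema for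
`p = ∞`. -/
noncomputable def weightedSobolevNorm {n : ℕ} (p : ℝ≥0∞) (U : Set (EuclideanSpace ℝ (Fin n)))
    (w : EuclideanSpace ℝ (Fin n) → ℝ) (h : EuclideanSpace ℝ (Fin n) → ℝ)
    (g : EuclideanSpace ℝ (Fin n) → EuclideanSpace ℝ (Fin n)) : ℝ :=
  if p = ⊤ then
    max (eLpNorm h ⊤ (weightedMeasure w U)).toReal (eLpNorm g ⊤ (weightedMeasure w U)).toReal
  else
    (∫ x, (|h x| ^ p.toReal + ‖g x‖ ^ p.toReal) ∂(weightedMeasure w U)) ^ (1 / p.toReal)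

/-- The error `E_V = ∫_Ω h ω^ε dx - ∫_D h dx` of the diffuse volume integral. -/
noncomputable def volumeError {n : ℕ} (S : ℝ → ℝ) (D Ω : Set (EuclideanSpace ℝ (Fin n))) (ε : ℝ)
    (h : EuclideanSpace ℝ (Fin n) → ℝ) : ℝ :=
  (∫ x in Ω, h x * phaseField S D ε x) - ∫ x in D, h x

end DiffuseDomain

/-! ### The oriented distance and its Lipschitz gradient near the boundary. -/

namespace DiffuseDomain

variable {n : ℕ} {D : Set (EuclideanSpace ℝ (Fin n))}

/-! Write d for the oriented distance and w for the profile with `phaseField` equal to w(d). The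
error is the integral of h (w(d) - 1_{d<0}) over |d| < ε, and a factor ε is gained by integrating by
parts in the normal direction. Near the boundary V = ∇d is a Lipschitz unit field, so div(G(d) V) =
G'(d) + G(d) div V for Lipschitz G, and ∫ h G'(d) = -∫ G(d) (∇h · V + h div V) whenever G(d) has
compact support in the tube (`IsNormalField.integral_mul_deriv_comp`). Oddness of S reads w(-t) = 1
- w(t); hence 1_{t<0} - w has the even primitive G(t) = ∫_{|t|}^ε w, which vanishes at both ends of
the tube, and monotonicity of w gives 0 ≤ G ≤ ε w. The weight thus survives, and the error is at
most a constant times ε times the weighted W^{1,1} norm on the tube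
(`IsNormalField.abs_integral_profile_sub_le`). Hölder's inequality on a tube of volume O(ε) supplies
the remaining ε^{1-1/p}.

The field V comes from a uniform two-sided ball condition (`HasC11Boundary.exists_hasTangentBalls`):
the distances to the centres of two tangent balls squeeze d to second order
(`exists_orientedDist_expansion`), which gives differentiability and the Lipschitz bound on ∇d
together. Since G(d) V is only Lipschitz, weak gradients must first be tested against Lipschitz
functions, by mollification (`IsWeakGradient.integral_mul_lineDeriv`). The tube volume follows from
the same integration by parts with h = 1 (`IsNormalField.volume_tube_le_of_le`). Widths ε larger
than that of the tube carrying V need only |w - 1_{t<0}| ≤ w. -/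

lemma orientedDist_of_mem {x : EuclideanSpace ℝ (Fin n)} (hx : x ∈ D) :
    orientedDist D x = -Metric.infDist x Dᶜ := by
  simp [orientedDist, Metric.infDist_zero_of_mem hx]

lemma orientedDist_of_notMem {x : EuclideanSpace ℝ (Fin n)} (hx : x ∉ D) :
    orientedDist D x = Metric.infDist x D := by
  simp [orientedDist, Metric.infDist_zero_of_mem (show x ∈ Dᶜ from hx)]

/-- A point q of the segment from x to z at distance r < dist(x, Dᶜ) from x still lies in D, so
dist(z, D) ≤ dist(z, q) = dist(x, z) - r; let r increase. This is the only case in which the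
Lipschitz constant 1 of the oriented distance is not inherited from a single distance function. -/
lemma infDist_add_infDist_compl_le {x z : EuclideanSpace ℝ (Fin n)} (hx : x ∈ D) (hz : z ∉ D) :
    Metric.infDist z D + Metric.infDist x Dᶜ ≤ dist x z := by
  have hne : x ≠ z := fun h => hz (h ▸ hx)
  have hL : 0 < dist x z := dist_pos.2 hne
  have hs : Metric.infDist x Dᶜ ≤ dist x z := Metric.infDist_le_dist_of_mem hz
  suffices H : ∀ r, 0 ≤ r → r < Metric.infDist x Dᶜ → r ≤ dist x z - Metric.infDist z D by
    have h0 : 0 ≤ dist x z - Metric.infDist z D := by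
      have := Metric.infDist_le_dist_of_mem (x := z) hx
      rw [dist_comm] at this
      linarith
    have : Metric.infDist x Dᶜ ≤ dist x z - Metric.infDist z D := by
      refine le_of_forall_lt_imp_le_of_dense fun r hr => ?_
      rcases le_or_gt 0 r with h | h
      · exact H r h hr
      · exact h.le.trans h0
    linarith
  intro r hr0 hr
  set q := AffineMap.lineMap x z (r / dist x z) with hq
  have h1 : dist x q = r := by
    rw [hq, dist_left_lineMap, Real.norm_of_nonneg (by positivity)]
    field_simp
  have h2 : dist z q = dist x z - r := by
    rw [hq, dist_right_lineMap, Real.norm_of_nonneg]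
    · field_simp
    · rw [sub_nonneg, div_le_one hL]; linarith
  have hqD : q ∈ D := by
    by_contra h
    have := Metric.infDist_le_dist_of_mem (x := x) (show q ∈ Dᶜ from h)
    linarith
  have := Metric.infDist_le_dist_of_mem (x := z) hqD
  linarith

lemma orientedDist_sub_le (x z : EuclideanSpace ℝ (Fin n)) :
    orientedDist D z - orientedDist D x ≤ dist x z := by
  by_cases hx : x ∈ D <;> by_cases hz : z ∈ D
  · rw [orientedDist_of_mem hx, orientedDist_of_mem hz]
    have := Metric.infDist_le_infDist_add_dist (s := Dᶜ) (x := x) (y := z)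
    linarith
  · rw [orientedDist_of_mem hx, orientedDist_of_notMem hz]
    have := infDist_add_infDist_compl_le hx hz
    linarith
  · rw [orientedDist_of_notMem hx, orientedDist_of_mem hz]
    have h1 : 0 ≤ Metric.infDist z Dᶜ := Metric.infDist_nonneg
    have h2 : 0 ≤ Metric.infDist x D := Metric.infDist_nonneg
    have := dist_nonneg (x := x) (y := z)
    linarith
  · rw [orientedDist_of_notMem hx, orientedDist_of_notMem hz]
    have := Metric.infDist_le_infDist_add_dist (s := D) (x := z) (y := x)
    rw [dist_comm z x] at this
    linarith

lemma lipschitzWith_orientedDist : LipschitzWith 1 (orientedDist D) := by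
  refine LipschitzWith.of_dist_le_mul fun x z => ?_
  rw [Real.dist_eq, NNReal.coe_one, one_mul, abs_le]
  have h1 := orientedDist_sub_le (D := D) x z
  have h2 := orientedDist_sub_le (D := D) z x
  rw [dist_comm z x] at h2
  constructor <;> linarith

lemma orientedDist_neg_iff (hD : IsOpen D) (hne : D ≠ univ) {x : EuclideanSpace ℝ (Fin n)} :
    orientedDist D x < 0 ↔ x ∈ D := by
  constructor
  · intro h
    by_contra hx
    rw [orientedDist_of_notMem hx] at h
    exact absurd Metric.infDist_nonneg (not_le.2 h)
  · intro hx
    rw [orientedDist_of_mem hx, neg_lt_zero]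
    exact (hD.isClosed_compl.notMem_iff_infDist_pos (nonempty_compl.2 hne)).1 (by simpa using hx)

/-- The first-order Taylor remainder of a function with Lipschitz derivative is quadratic. -/
lemma abs_sub_sub_fderiv_le {E : Type*} [NormedAddCommGroup E] [NormedSpace ℝ E] {γ : E → ℝ}
    {K : ℝ≥0} (hγ : ContDiff ℝ 1 γ) (hK : LipschitzWith K (fderiv ℝ γ)) (a b : E) :
    |γ b - γ a - fderiv ℝ γ a (b - a)| ≤ K * ‖b - a‖ ^ 2 := by
  have := (convex_closedBall a ‖b - a‖).norm_image_sub_le_of_norm_hasFDerivWithin_le' (f := γ)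
    (f' := fderiv ℝ γ) (φ := fderiv ℝ γ a) (C := K * ‖b - a‖) (x := a) (y := b)
    (fun x _ => ((hγ.differentiable one_ne_zero) x).hasFDerivAt.hasFDerivWithinAt)
    (fun x hx => by
      have h1 := hK.norm_sub_le x a
      have h2 : ‖x - a‖ ≤ ‖b - a‖ := by simpa [dist_eq_norm] using hx
      exact h1.trans (by gcongr))
    (by simp) (by simp [dist_eq_norm])
  rw [Real.norm_eq_abs] at this
  linarith [this, sq ‖b - a‖, mul_assoc (K : ℝ) ‖b - a‖ ‖b - a‖]

/-- Near a frontier point of a set with `C^{1,1}` boundary, the set is the sublevel set of a function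
with quadratic Taylor remainders at the frontier. -/
lemma HasC11Boundary.exists_local_defining (hbd : HasC11Boundary D) (hD : IsOpen D)
    {x₀ : EuclideanSpace ℝ (Fin n)} (hx₀ : x₀ ∈ frontier D) :
    ∃ (r K : ℝ) (G : EuclideanSpace ℝ (Fin n) → ℝ), 0 < r ∧ 0 < K ∧
      (∀ x ∈ Metric.ball x₀ r, (x ∈ D ↔ G x < 0)) ∧
      ∀ y ∈ Metric.ball x₀ r ∩ frontier D, ∃ m : EuclideanSpace ℝ (Fin n), 1 ≤ ‖m‖ ∧
        ∀ z, |G z - ⟪m, z - y⟫| ≤ K * ‖z - y‖ ^ 2 := by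
  obtain ⟨ν, r, γ, K, hν, hr, hγ, hK, hiff⟩ := hbd x₀ hx₀
  let P : EuclideanSpace ℝ (Fin n) →L[ℝ] EuclideanSpace ℝ (Fin n) :=
    ContinuousLinearMap.id ℝ _ - (innerSL ℝ ν).smulRight ν
  have hP : ∀ x, P x = x - ⟪ν, x⟫ • ν := fun x => by simp [P]
  have hPν : P ν = 0 := by rw [hP]; simp [hν]
  let G : EuclideanSpace ℝ (Fin n) → ℝ := fun x => ⟪ν, x⟫ - γ (P x)
  have hGc : Continuous G := by
    have := hγ.continuous
    fun_prop
  have hiff' : ∀ x ∈ Metric.ball x₀ r, (x ∈ D ↔ G x < 0) := fun x hx => by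
    rw [hiff x hx, ← hP, sub_neg]
  refine ⟨r, K * ‖P‖ ^ 2 + 1, G, hr, by positivity, hiff', ?_⟩
  rintro y ⟨hyb, hyf⟩
  -- If G y > 0, a neighbourhood of y would miss D; if G y < 0, then y would lie in the open set D,
  -- which is disjoint from its frontier.
  have hG0 : G y = 0 := by
    apply le_antisymm
    · by_contra! h
      have hU : IsOpen (Metric.ball x₀ r ∩ {x | 0 < G x}) :=
        Metric.isOpen_ball.inter (isOpen_lt continuous_const hGc)
      obtain ⟨q, ⟨hqb, hqG⟩, hqD⟩ :=
        mem_closure_iff.1 (frontier_subset_closure hyf) _ hU ⟨hyb, h⟩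
      exact absurd ((hiff' q hqb).1 hqD) (not_lt.2 (le_of_lt hqG))
    · by_contra! h
      have hyD := (hiff' y hyb).2 h
      rw [hD.frontier_eq] at hyf
      exact hyf.2 hyD
  -- The derivative of G at y. Since P ν = 0, it takes the value 1 at the unit vector ν, so the
  -- gradient m has norm at least 1.
  let A : EuclideanSpace ℝ (Fin n) →L[ℝ] ℝ := innerSL ℝ ν - (fderiv ℝ γ (P y)).comp P
  refine ⟨(InnerProductSpace.toDual ℝ _).symm A, ?_, fun z => ?_⟩
  · rw [LinearIsometryEquiv.norm_map]
    have := A.le_opNorm ν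
    have h2 : A ν = 1 := by simp [A, hPν, hν]
    rw [h2, hν] at this
    simpa using this
  · rw [InnerProductSpace.toDual_symm_apply]
    have h1 := abs_sub_sub_fderiv_le hγ hK (P y) (P z)
    have h2 : G z - A (z - y) = -(γ (P z) - γ (P y) - fderiv ℝ γ (P y) (P z - P y)) := by
      have : G z - A (z - y) = G z - G y - A (z - y) := by rw [hG0]; ring
      rw [this]
      simp only [G, A, sub_apply, innerSL_apply_apply, map_sub,
        ContinuousLinearMap.comp_apply]
      ring
    rw [h2, abs_neg]
    refine h1.trans ?_
    rw [← map_sub]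
    have h3 := P.le_opNorm (z - y)
    calc (K : ℝ) * ‖P (z - y)‖ ^ 2 ≤ K * (‖P‖ * ‖z - y‖) ^ 2 := by gcongr
      _ ≤ (K * ‖P‖ ^ 2 + 1) * ‖z - y‖ ^ 2 := by nlinarith [sq_nonneg ‖z - y‖]

/-- The two-sided ball condition of radius `ρ` with normal `u` at `y`. -/
def HasTangentBalls (D : Set (EuclideanSpace ℝ (Fin n))) (ρ : ℝ)
    (y u : EuclideanSpace ℝ (Fin n)) : Prop :=
  ‖u‖ = 1 ∧ Metric.ball (y - ρ • u) ρ ⊆ D ∧ Metric.ball (y + ρ • u) ρ ⊆ Dᶜ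

lemma two_mul_inner_lt_of_mem_ball {ρ : ℝ} {y u z : EuclideanSpace ℝ (Fin n)} (hρ : 0 < ρ)
    (hu : ‖u‖ = 1) (hz : z ∈ Metric.ball (y + ρ • u) ρ) :
    ‖z - y‖ ^ 2 < 2 * ρ * ⟪u, z - y⟫ ∧ ‖z - y‖ < 2 * ρ := by
  rw [mem_ball_iff_norm] at hz
  have h1 : z - (y + ρ • u) = (z - y) - ρ • u := by abel
  rw [h1] at hz
  have h2 : ‖(z - y) - ρ • u‖ ^ 2 < ρ ^ 2 := by gcongr
  rw [norm_sub_sq_real, inner_smul_right, norm_smul, hu, Real.norm_of_nonneg hρ.le,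
    real_inner_comm] at h2
  constructor
  · nlinarith
  · have h3 := norm_sub_norm_le (z - y) (ρ • u)
    rw [norm_smul, hu, Real.norm_of_nonneg hρ.le] at h3
    linarith

/-- In a ball of radius ρ tangent at y with centre y + ρu one has |z - y|² < 2ρ ⟪u, z - y⟫. When 2ρK
≤ 1 the linear part of the defining function G therefore beats its quadratic remainder, and G has a
constant sign on each of the two balls. Compactness of the frontier makes ρ uniform. -/
lemma HasC11Boundary.exists_hasTangentBalls (hbd : HasC11Boundary D) (hD : IsOpen D)
    (hb : Bornology.IsBounded D) :
    ∃ ρ : ℝ, 0 < ρ ∧ ∀ y ∈ frontier D, ∃ u, HasTangentBalls D ρ y u := by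
  have hcomp : IsCompact (frontier D) :=
    Metric.isCompact_of_isClosed_isBounded isClosed_frontier
      (hb.closure.subset frontier_subset_closure)
  -- Asking for all radii up to ρ₀ makes the property stable under unions, by taking the smaller ρ₀.
  suffices H : ∃ ρ₀ : ℝ, 0 < ρ₀ ∧ ∀ ρ, 0 < ρ → ρ ≤ ρ₀ → ∀ y ∈ frontier D,
      ∃ u, HasTangentBalls D ρ y u by
    obtain ⟨ρ₀, h0, h⟩ := H
    exact ⟨ρ₀, h0, h ρ₀ h0 le_rfl⟩
  refine hcomp.induction_on (p := fun s => ∃ ρ₀ : ℝ, 0 < ρ₀ ∧ ∀ ρ, 0 < ρ → ρ ≤ ρ₀ → ∀ y ∈ s,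
      ∃ u, HasTangentBalls D ρ y u) ⟨1, one_pos, by simp⟩ ?_ ?_ ?_
  · rintro s t hst ⟨ρ₀, h0, h⟩
    exact ⟨ρ₀, h0, fun ρ hρ hle y hy => h ρ hρ hle y (hst hy)⟩
  · rintro s t ⟨ρ₁, h1, H1⟩ ⟨ρ₂, h2, H2⟩
    refine ⟨min ρ₁ ρ₂, lt_min h1 h2, fun ρ hρ hle y hy => ?_⟩
    rcases hy with hy | hy
    · exact H1 ρ hρ (hle.trans (min_le_left _ _)) y hy
    · exact H2 ρ hρ (hle.trans (min_le_right _ _)) y hy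
  · intro x₀ hx₀
    obtain ⟨r, K, G, hr, hK, hiff, hG⟩ := hbd.exists_local_defining hD hx₀
    -- The bound r/4 keeps both tangent balls, of diameter 2ρ ≤ r/2, in the ball where G describes
    -- D; the bound 1/(2K) gives 2ρK ≤ 1.
    refine ⟨Metric.ball x₀ (r / 2) ∩ frontier D,
      Filter.inter_mem (mem_nhdsWithin_of_mem_nhds (Metric.ball_mem_nhds _ (by positivity)))
        self_mem_nhdsWithin, min (r / 4) (1 / (2 * K)),
      by positivity, fun ρ hρ hle y hy => ?_⟩
    have hρr : 4 * ρ ≤ r := by linarith [hle.trans (min_le_left _ _)]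
    have hρK : 2 * ρ * K ≤ 1 := by
      have := hle.trans (min_le_right _ _)
      rw [le_div_iff₀ (by positivity)] at this
      linarith
    obtain ⟨m, hm, hmG⟩ := hG y ⟨Metric.ball_subset_ball (by linarith) hy.1, hy.2⟩
    have hm0 : 0 < ‖m‖ := by linarith
    have hmu : m = ‖m‖ • (‖m‖⁻¹ • m) := by rw [smul_smul, mul_inv_cancel₀ hm0.ne', one_smul]
    have hu : ‖‖m‖⁻¹ • m‖ = 1 := by
      rw [norm_smul, norm_inv, norm_norm, inv_mul_cancel₀ hm0.ne']
    generalize ‖m‖⁻¹ • m = u at hmu hu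
    have hin : ∀ z, ⟪m, z - y⟫ = ‖m‖ * ⟪u, z - y⟫ := fun z => by
      conv_lhs => rw [hmu]
      rw [real_inner_smul_left]
    have hball : ∀ z, ‖z - y‖ < 2 * ρ → z ∈ Metric.ball x₀ r := fun z hz => by
      have h1 : dist y x₀ < r / 2 := hy.1
      rw [Metric.mem_ball]
      calc dist z x₀ ≤ dist z y + dist y x₀ := dist_triangle _ _ _
        _ < 2 * ρ + r / 2 := by rw [dist_eq_norm]; linarith
        _ ≤ r := by linarith
    have key : ∀ (t : ℝ) (z : EuclideanSpace ℝ (Fin n)), ‖z - y‖ ^ 2 < 2 * ρ * t →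
        K * ‖z - y‖ ^ 2 < ‖m‖ * t := fun t z h => by
      have ht : 0 < t := by
        by_contra! h'
        nlinarith [sq_nonneg ‖z - y‖]
      calc K * ‖z - y‖ ^ 2 < K * (2 * ρ * t) := by gcongr
        _ = (2 * ρ * K) * t := by ring
        _ ≤ 1 * t := by gcongr
        _ ≤ ‖m‖ * t := by gcongr
    refine ⟨u, hu, fun z hz => ?_, fun z hz => ?_⟩
    · have hz' : z ∈ Metric.ball (y + ρ • (-u)) ρ := by simpa [sub_eq_add_neg] using hz
      obtain ⟨h1, h2⟩ := two_mul_inner_lt_of_mem_ball hρ (by simpa using hu) hz'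
      have h3 := key _ z h1
      rw [hiff z (hball z h2)]
      have h4 := (abs_le.1 (hmG z)).2
      rw [hin] at h4
      rw [inner_neg_left] at h3
      linarith
    · obtain ⟨h1, h2⟩ := two_mul_inner_lt_of_mem_ball hρ hu hz
      have h3 := key _ z h1
      rw [mem_compl_iff, hiff z (hball z h2), not_lt]
      have h4 := (abs_le.1 (hmG z)).1
      rw [hin] at h4
      linarith

lemma exists_frontier_dist_eq_abs_orientedDist (hne : D.Nonempty) (hne' : D ≠ univ)
    (x : EuclideanSpace ℝ (Fin n)) : ∃ y ∈ frontier D, dist x y = |orientedDist D x| := by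
  by_cases hx : x ∈ D
  · obtain ⟨y, hy, h⟩ := exists_mem_frontier_infDist_compl_eq_dist hx hne'
    refine ⟨y, hy, ?_⟩
    rw [orientedDist_of_mem hx, abs_neg, abs_of_nonneg Metric.infDist_nonneg, h]
  · obtain ⟨y, hy, h⟩ := exists_mem_frontier_infDist_compl_eq_dist (s := Dᶜ) hx
      (by simpa [compl_univ_iff] using hne.ne_empty)
    rw [frontier_compl] at hy
    rw [compl_compl] at h
    refine ⟨y, hy, ?_⟩
    rw [orientedDist_of_notMem hx, abs_of_nonneg Metric.infDist_nonneg, h]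

/-- The square of the right-hand side exceeds that of the left by (⟪u, w⟫ + ‖w‖²/(2A))². This is the
second-order upper bound for the distance to the centre of a tangent ball. -/
lemma norm_smul_add_le {A : ℝ} (hA : 0 < A) {u : EuclideanSpace ℝ (Fin n)} (hu : ‖u‖ = 1)
    (w : EuclideanSpace ℝ (Fin n)) : ‖A • u + w‖ ≤ A + ⟪u, w⟫ + ‖w‖ ^ 2 / (2 * A) := by
  have hq : ⟪u, w⟫ ^ 2 ≤ ‖w‖ ^ 2 := by
    have := abs_real_inner_le_norm u w
    rw [hu, one_mul] at this
    exact sq_le_sq' (by linarith [neg_abs_le ⟪u, w⟫]) (by linarith [le_abs_self ⟪u, w⟫])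
  have hn : ‖A • u + w‖ ^ 2 = A ^ 2 + 2 * A * ⟪u, w⟫ + ‖w‖ ^ 2 := by
    rw [norm_add_sq_real, norm_smul, hu, real_inner_smul_left, Real.norm_of_nonneg hA.le]
    ring
  set q := ⟪u, w⟫
  set m := ‖w‖ ^ 2
  have hm : m / (2 * A) * (2 * A) = m := by field_simp
  set e := m / (2 * A)
  refine abs_le_of_sq_le_sq' ?_ ?_ |>.2
  · rw [hn]; nlinarith [sq_nonneg (q + e)]
  · nlinarith [sq_nonneg (A + q), sq_nonneg A]

/-- Equality case of the triangle inequality: it places x on the normal line through its nearest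
boundary point. -/
lemma eq_smul_of_le_norm_add {ρ s : ℝ} {p u : EuclideanSpace ℝ (Fin n)} (hρ : 0 < ρ)
    (hu : ‖u‖ = 1) (hp : ‖p‖ = s) (h : s + ρ ≤ ‖p + ρ • u‖) : p = s • u := by
  have hs : 0 ≤ s := hp ▸ norm_nonneg p
  have h1 : (s + ρ) ^ 2 ≤ ‖p + ρ • u‖ ^ 2 := by gcongr
  rw [norm_add_sq_real, norm_smul, hu, inner_smul_right, Real.norm_of_nonneg hρ.le, hp] at h1
  have h2 : s ≤ ⟪p, u⟫ := by
    have : 0 ≤ ρ * (⟪p, u⟫ - s) := by nlinarith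
    linarith [nonneg_of_mul_nonneg_right this hρ]
  have h3 : ‖p - s • u‖ ^ 2 ≤ 0 := by
    rw [norm_sub_sq_real, norm_smul, hu, inner_smul_right, Real.norm_of_nonneg hs, hp]
    nlinarith
  have h4 : ‖p - s • u‖ = 0 := by
    have := sq_nonneg ‖p - s • u‖
    exact pow_eq_zero_iff two_ne_zero |>.1 (le_antisymm h3 this)
  exact sub_eq_zero.1 (norm_eq_zero.1 h4)

/-- Quadratic first-order expansion of the oriented distance in a tube around the boundary. -/
lemma exists_orientedDist_expansion {ρ : ℝ} (hρ : 0 < ρ) (hne : D.Nonempty) (hne' : D ≠ univ)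
    (hballs : ∀ y ∈ frontier D, ∃ u, HasTangentBalls D ρ y u) (x : EuclideanSpace ℝ (Fin n))
    (hx : |orientedDist D x| < ρ / 2) :
    ∃ u : EuclideanSpace ℝ (Fin n), ‖u‖ = 1 ∧
      ∀ z, |orientedDist D z - orientedDist D x - ⟪u, z - x⟫| ≤ 1 / ρ * ‖z - x‖ ^ 2 := by
  obtain ⟨y, hy, hxy⟩ := exists_frontier_dist_eq_abs_orientedDist hne hne' x
  obtain ⟨u, hu, hin, hout⟩ := hballs y hy
  -- The centres of the tangent balls satisfy d(a) ≤ -ρ and d(b) ≥ ρ. As d is 1-Lipschitz, it is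
  -- trapped between ρ - ‖z - b‖ and ‖z - a‖ - ρ, and both bounds are attained at z = x.
  set a := y - ρ • u with ha
  set b := y + ρ • u with hb
  have hda : orientedDist D a ≤ -ρ := by
    have haD : a ∈ D := hin (Metric.mem_ball_self hρ)
    rw [orientedDist_of_mem haD, neg_le_neg_iff, Metric.le_infDist (nonempty_compl.2 hne')]
    intro q hq
    by_contra! h
    exact hq (hin (by rwa [Metric.mem_ball, dist_comm]))
  have hdb : ρ ≤ orientedDist D b := by
    have hbD : b ∉ D := hout (Metric.mem_ball_self hρ)
    rw [orientedDist_of_notMem hbD, Metric.le_infDist hne]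
    intro q hq
    by_contra! h
    exact hout (by rwa [Metric.mem_ball, dist_comm]) hq
  have hup : ∀ z, orientedDist D z ≤ ‖z - a‖ - ρ := fun z => by
    have := orientedDist_sub_le (D := D) a z
    rw [dist_comm, dist_eq_norm] at this
    linarith
  have hlo : ∀ z, ρ - ‖z - b‖ ≤ orientedDist D z := fun z => by
    have := orientedDist_sub_le (D := D) z b
    rw [dist_eq_norm] at this
    linarith
  set s := orientedDist D x with hs
  have hxs : x - y = s • u := by
    rw [dist_eq_norm] at hxy
    rcases le_or_gt 0 s with h | h
    · refine eq_smul_of_le_norm_add hρ hu (by rw [hxy, abs_of_nonneg h]) ?_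
      have := hup x
      rw [ha, show x - (y - ρ • u) = x - y + ρ • u by abel] at this
      linarith
    · have : x - y = (-s) • (-u) := by
        refine eq_smul_of_le_norm_add hρ (by simpa using hu) (by rw [hxy, abs_of_neg h]) ?_
        have := hlo x
        rw [hb, show x - (y + ρ • u) = x - y + ρ • (-u) by rw [smul_neg]; abel] at this
        linarith
      simpa using this
  obtain ⟨hs1, hs2⟩ := abs_lt.1 hx
  -- Since |s| < ρ/2, the distances ρ + s and ρ - s from x to the two centres are at least ρ/2;
  -- hence the constant 1/ρ.
  have aux : ∀ A w : ℝ, ρ / 2 ≤ A → 0 ≤ w → w / (2 * A) ≤ 1 / ρ * w := fun A w hA hw => by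
    rw [one_div_mul_eq_div]
    gcongr
    linarith
  refine ⟨u, hu, fun z => ?_⟩
  have h1 : z - a = (s + ρ) • u + (z - x) := by
    rw [add_smul, ← hxs, ha]; abel
  have h2 : z - b = (ρ - s) • (-u) + (z - x) := by
    rw [sub_smul, smul_neg, smul_neg, ← hxs, hb]; abel
  have h3 := norm_smul_add_le (A := s + ρ) (by linarith) hu (z - x)
  have h4 := norm_smul_add_le (A := ρ - s) (by linarith) (u := -u) (by simpa using hu) (z - x)
  have h5 := aux (s + ρ) (‖z - x‖ ^ 2) (by linarith) (by positivity)
  have h6 := aux (ρ - s) (‖z - x‖ ^ 2) (by linarith) (by positivity)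
  have h7 := hup z
  have h8 := hlo z
  rw [h1] at h7
  rw [h2] at h8
  rw [inner_neg_left] at h4
  rw [abs_le]
  constructor <;> linarith

/-- Vectors giving quadratic first-order expansions of a function depend on the base point in a
Lipschitz way. -/
lemma norm_sub_le_of_expansion {d : EuclideanSpace ℝ (Fin n) → ℝ} {C : ℝ} (hC : 0 ≤ C)
    {x x' u u' : EuclideanSpace ℝ (Fin n)} (hne : x ≠ x')
    (hx : ∀ z, |d z - d x - ⟪u, z - x⟫| ≤ C * ‖z - x‖ ^ 2)
    (hx' : ∀ z, |d z - d x' - ⟪u', z - x'⟫| ≤ C * ‖z - x'‖ ^ 2) :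
    ‖u - u'‖ ≤ 6 * C * ‖x - x'‖ := by
  have hr : 0 < ‖x - x'‖ := norm_pos_iff.2 (sub_ne_zero.2 hne)
  set r := ‖x - x'‖ with hrdef
  rw [norm_sub_rev]
  rcases eq_or_ne (u' - u) 0 with hv | hv
  · rw [hv, norm_zero]; positivity
  have hv' : 0 < ‖u' - u‖ := norm_pos_iff.2 hv
  set v := u' - u with hvdef
  -- Moving from x by r in the direction of u' - u makes the gap between the two linear forms equal
  -- to r‖v‖. Three remainders control it: C(2r)² at z from x', C r² at z from x, and C r² at x from
  -- x', in total 6Cr².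
  set z := x + (r / ‖v‖) • v with hz
  have hzx : z - x = (r / ‖v‖) • v := by rw [hz]; abel
  have h1 : ‖z - x‖ = r := by
    rw [hzx, norm_smul, Real.norm_of_nonneg (by positivity), div_mul_cancel₀ _ hv'.ne']
  have h2 : ‖z - x'‖ ≤ 2 * r := by
    calc ‖z - x'‖ = ‖(z - x) + (x - x')‖ := by rw [sub_add_sub_cancel]
      _ ≤ ‖z - x‖ + ‖x - x'‖ := norm_add_le _ _
      _ = 2 * r := by rw [h1, ← hrdef]; ring
  have h3 : ⟪v, z - x⟫ = r * ‖v‖ := by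
    rw [hzx, inner_smul_right, real_inner_self_eq_norm_sq]
    field_simp
  have h4 : ⟪u', z - x'⟫ - ⟪u', x - x'⟫ - ⟪u, z - x⟫ = ⟪v, z - x⟫ := by
    rw [← inner_sub_right, sub_sub_sub_cancel_right, ← inner_sub_left]
  have e1 := (abs_le.1 (hx' z)).1
  have e2 := (abs_le.1 (hx z)).2
  have e3 := (abs_le.1 (hx' x)).2
  have h5 : C * ‖z - x'‖ ^ 2 ≤ C * (2 * r) ^ 2 := by gcongr
  rw [h1] at e2
  rw [← hrdef] at e3
  have h6 : r * ‖v‖ ≤ r * (6 * C * r) := by rw [← h3]; nlinarith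
  exact le_of_mul_le_mul_left h6 hr

/-- In a tube around a `C^{1,1}` boundary the oriented distance is differentiable, and its gradient,
a unit vector, is the restriction of a bounded Lipschitz vector field on the whole space. -/
theorem exists_normal_field (hD : IsOpen D) (hb : Bornology.IsBounded D) (hne : D.Nonempty)
    (hne' : D ≠ univ) (hbd : HasC11Boundary D) :
    ∃ (δ : ℝ) (L : ℝ≥0) (V : EuclideanSpace ℝ (Fin n) → EuclideanSpace ℝ (Fin n)), 0 < δ ∧
      (∀ i, LipschitzWith L (fun x => V x i)) ∧ (∀ x i, |V x i| ≤ 1) ∧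
      ∀ x, |orientedDist D x| < δ →
        ‖V x‖ = 1 ∧ HasFDerivAt (orientedDist D) (innerSL ℝ (V x)) x := by
  obtain ⟨ρ, hρ, hballs⟩ := hbd.exists_hasTangentBalls hD hb
  have hexp := exists_orientedDist_expansion hρ hne hne' hballs
  choose! u hu1 hu2 using hexp
  have hcoord : ∀ (v : EuclideanSpace ℝ (Fin n)) i, |v i| ≤ ‖v‖ := fun v i => by
    simpa using PiLp.norm_apply_le v i
  let L : ℝ≥0 := ⟨6 * (1 / ρ), by positivity⟩
  have hLip : ∀ i, LipschitzOnWith L (fun x => u x i) {x | |orientedDist D x| < ρ / 2} := by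
    intro i
    refine LipschitzOnWith.of_dist_le_mul fun x hx x' hx' => ?_
    rw [Real.dist_eq, dist_eq_norm]
    rcases eq_or_ne x x' with rfl | hxx
    · simp
    · exact (hcoord (u x - u x') i).trans
        (norm_sub_le_of_expansion (by positivity) hxx (hu2 x hx) (hu2 x' hx'))
  -- Each coordinate is extended separately and then truncated to [-1, 1]; truncation changes
  -- nothing in the tube, where u is a unit vector.
  choose v hv1 hv2 using fun i => (hLip i).extend_real
  refine ⟨ρ / 2, L, fun x => WithLp.toLp 2 fun i => max (-1) (min 1 (v i x)), by positivity,
    fun i => ?_, fun x i => ?_, fun x hx => ?_⟩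
  · exact ((hv1 i).const_min 1).const_max (-1)
  · rw [abs_le]
    exact ⟨le_max_left _ _, max_le (by norm_num) (min_le_left _ _)⟩
  · have hV : (WithLp.toLp 2 fun i => max (-1) (min 1 (v i x))) = u x := by
      ext i
      have h1 : v i x = u x i := (hv2 i hx).symm
      have h2 := abs_le.1 ((hcoord (u x) i).trans (hu1 x hx).le)
      simp only [h1]
      rw [min_eq_right h2.2, max_eq_right h2.1]
    beta_reduce
    rw [hV]
    refine ⟨hu1 x hx, ?_⟩
    rw [hasFDerivAt_iff_isLittleO]
    refine Asymptotics.IsBigO.trans_isLittleO (g := fun z => ‖z - x‖ ^ 2) ?_ ?_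
    · refine Asymptotics.IsBigO.of_bound (1 / ρ) (Filter.Eventually.of_forall fun z => ?_)
      simpa [Real.norm_eq_abs] using hu2 x hx z
    · exact (Asymptotics.isLittleO_pow_sub_sub x one_lt_two)

end DiffuseDomain

/-! ### Testing weak gradients against Lipschitz functions, by mollification. -/

namespace DiffuseDomain

section Mollification
open scoped Convolution

variable {n : ℕ}

/-- The derivative is put on φ, under the integral: a Lipschitz function is differentiable almost
everywhere along v, and its difference quotients are dominated by C‖v‖. -/
lemma fderiv_normed_convolution (ψ : ContDiffBump (0 : EuclideanSpace ℝ (Fin n)))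
    {φ : EuclideanSpace ℝ (Fin n) → ℝ} {C : ℝ≥0} (hφ : LipschitzWith C φ)
    (x v : EuclideanSpace ℝ (Fin n)) :
    fderiv ℝ (ψ.normed volume ⋆[ContinuousLinearMap.lsmul ℝ ℝ, volume] φ) x v =
      (ψ.normed volume ⋆[ContinuousLinearMap.lsmul ℝ ℝ, volume] fun y => lineDeriv ℝ φ y v) x := by
  have hcd : ContDiff ℝ 1 (ψ.normed volume ⋆[ContinuousLinearMap.lsmul ℝ ℝ, volume] φ) :=
    ψ.hasCompactSupport_normed.contDiff_convolution_left (n := 1) _ ψ.contDiff_normed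
      hφ.continuous.locallyIntegrable
  rw [← ((hcd.differentiable one_ne_zero) x).lineDeriv_eq_fderiv]
  have hae : ∀ᵐ t : EuclideanSpace ℝ (Fin n), LineDifferentiableAt ℝ φ (x - t) v :=
    (Measure.measurePreserving_sub_left volume x).quasiMeasurePreserving.ae (hφ.ae_lineDifferentiableAt v)
  have hint : ∀ y, Integrable (fun t => ψ.normed volume t * φ (y - t)) := fun y =>
    (ψ.continuous_normed.mul (hφ.continuous.comp (continuous_const.sub
      continuous_id))).integrable_of_hasCompactSupport ψ.hasCompactSupport_normed.mul_right
  have key := hasDerivAt_integral_of_dominated_loc_of_lip (μ := volume) (x₀ := (0 : ℝ))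
    (s := univ) (bound := fun t => ψ.normed volume t * (C * ‖v‖))
    (F := fun s t => ψ.normed volume t * φ (x + s • v - t))
    (F' := fun t => ψ.normed volume t * lineDeriv ℝ φ (x - t) v) Filter.univ_mem
    (Filter.Eventually.of_forall fun s => (hint _).aestronglyMeasurable) (hint _)
    (by
      refine ψ.continuous_normed.aestronglyMeasurable.mul ?_
      exact ((measurable_lineDeriv hφ.continuous).comp
        (measurable_const.sub measurable_id)).aestronglyMeasurable)
    (Filter.Eventually.of_forall fun t => by
      rw [lipschitzOnWith_univ]
      refine LipschitzWith.of_dist_le_mul fun s s' => ?_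
      have h0 : 0 ≤ ψ.normed volume t := ψ.nonneg_normed t
      rw [Real.coe_nnabs, abs_of_nonneg (by positivity), Real.dist_eq, ← mul_sub, abs_mul,
        abs_of_nonneg h0, mul_assoc]
      refine mul_le_mul_of_nonneg_left ?_ h0
      have := hφ.dist_le_mul (x + s • v - t) (x + s' • v - t)
      rw [Real.dist_eq, dist_eq_norm] at this
      refine this.trans (le_of_eq ?_)
      rw [show x + s • v - t - (x + s' • v - t) = (s - s') • v by rw [sub_smul]; abel, norm_smul,
        Real.dist_eq, Real.norm_eq_abs]
      ring)
    (ψ.integrable_normed.mul_const _)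
    (by
      filter_upwards [hae] with t ht
      have h1 := ht.hasLineDerivAt
      unfold HasLineDerivAt at h1
      have h2 := h1.const_mul (ψ.normed volume t)
      refine h2.congr_of_eventuallyEq (Filter.Eventually.of_forall fun s => ?_)
      simp only
      rw [show x + s • v - t = x - t + s • v by abel])
  have h2 := key.2
  have h3 : HasLineDerivAt ℝ (ψ.normed volume ⋆[ContinuousLinearMap.lsmul ℝ ℝ, volume] φ)
      (∫ t, ψ.normed volume t * lineDeriv ℝ φ (x - t) v) x v := h2
  rw [h3.lineDeriv]
  rfl

lemma abs_normed_convolution_le (ψ : ContDiffBump (0 : EuclideanSpace ℝ (Fin n)))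
    {f : EuclideanSpace ℝ (Fin n) → ℝ} {M : ℝ} (hf : ∀ x, |f x| ≤ M)
    (x : EuclideanSpace ℝ (Fin n)) :
    |(ψ.normed volume ⋆[ContinuousLinearMap.lsmul ℝ ℝ, volume] f) x| ≤ M := by
  have h1 : ‖∫ t, ψ.normed volume t * f (x - t)‖ ≤ ∫ t, ψ.normed volume t * M := by
    refine norm_integral_le_of_norm_le (ψ.integrable_normed.mul_const M)
      (Filter.Eventually.of_forall fun t => ?_)
    rw [norm_mul, Real.norm_of_nonneg (ψ.nonneg_normed t)]
    exact mul_le_mul_of_nonneg_left (hf _) (ψ.nonneg_normed t)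
  rw [integral_mul_const, ψ.integral_normed, one_mul] at h1
  exact h1

/-- A weak gradient may be tested against Lipschitz functions with compact support. -/
theorem IsWeakGradient.integral_mul_lineDeriv {U : Set (EuclideanSpace ℝ (Fin n))}
    {h : EuclideanSpace ℝ (Fin n) → ℝ} {g : EuclideanSpace ℝ (Fin n) → EuclideanSpace ℝ (Fin n)}
    (hw : IsWeakGradient U h g) (hU : IsOpen U) {φ : EuclideanSpace ℝ (Fin n) → ℝ} {C : ℝ≥0}
    (hφ : LipschitzWith C φ) (hc : HasCompactSupport φ) (hs : tsupport φ ⊆ U) (i : Fin n) :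
    ∫ x in U, h x * lineDeriv ℝ φ x (EuclideanSpace.single i 1) = -∫ x in U, g x i * φ x := by
  set v : EuclideanSpace ℝ (Fin n) := EuclideanSpace.single i 1 with hv
  -- With mollification radii at most δ, all regularized functions are supported in one compact set
  -- K inside U, on which h and g are integrable.
  obtain ⟨δ, hδ, hδU⟩ := IsCompact.exists_cthickening_subset_open hc hU hs
  set K := Metric.cthickening δ (tsupport φ) with hK
  have hKc : IsCompact K := hc.cthickening
  let ψ : ℕ → ContDiffBump (0 : EuclideanSpace ℝ (Fin n)) := fun k =>
    { rIn := δ / (k + 1) / 2, rOut := δ / (k + 1), rIn_pos := by positivity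
      rIn_lt_rOut := half_lt_self (by positivity) }
  have hψlim : Filter.Tendsto (fun k => (ψ k).rOut) Filter.atTop (nhds 0) :=
    tendsto_const_div_atTop_nhds_zero_nat δ |>.comp (Filter.tendsto_add_atTop_nat 1) |>.congr
      fun k => by simp [ψ]
  have hψle : ∀ k, (ψ k).rOut ≤ δ := fun k => by
    simp only [ψ]
    exact div_le_self hδ.le (by linarith [k.cast_nonneg (α := ℝ)])
  let φk : ℕ → EuclideanSpace ℝ (Fin n) → ℝ := fun k =>
    (ψ k).normed volume ⋆[ContinuousLinearMap.lsmul ℝ ℝ, volume] φ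
  have hsupp : ∀ k (f : EuclideanSpace ℝ (Fin n) → ℝ), Function.support f ⊆ tsupport φ →
      Function.support ((ψ k).normed volume ⋆[ContinuousLinearMap.lsmul ℝ ℝ, volume] f) ⊆ K := by
    intro k f hf
    refine (support_convolution_subset _).trans ?_
    rw [(ψ k).support_normed_eq]
    rintro _ ⟨a, ha, b, hb, rfl⟩
    refine Metric.mem_cthickening_of_dist_le _ b _ _ (hf hb) ?_
    have : ‖a‖ < (ψ k).rOut := by simpa using ha
    simpa using this.le.trans (hψle k)
  have hlsupp : Function.support (fun y => lineDeriv ℝ φ y v) ⊆ tsupport φ := by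
    intro y hy
    by_contra hy'
    apply hy
    have h0 : φ =ᶠ[nhds y] fun _ => 0 := notMem_tsupport_iff_eventuallyEq.1 hy'
    have h1 := h0.lineDeriv_eq (𝕜 := ℝ) (v := v)
    exact h1.trans (by simp [lineDeriv])
  have hcd : ∀ k, ContDiff ℝ ∞ (φk k) := fun k =>
    (ψ k).hasCompactSupport_normed.contDiff_convolution_left (n := ⊤) _ (ψ k).contDiff_normed
      hφ.continuous.locallyIntegrable
  have hts : ∀ k, tsupport (φk k) ⊆ K := fun k =>
    closure_minimal (hsupp k φ (subset_tsupport φ)) Metric.isClosed_cthickening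
  have heq : ∀ k, ∫ x in U, h x * fderiv ℝ (φk k) x v = -∫ x in U, g x i * φk k x := fun k =>
    hw.integral_eq (φk k) (hcd k) (hKc.of_isClosed_subset (isClosed_tsupport _) (hts k))
      ((hts k).trans hδU) i
  obtain ⟨M, hM⟩ : ∃ M, ∀ x, |φ x| ≤ M := by
    obtain ⟨M, hM⟩ := hφ.continuous.bounded_above_of_compact_support hc
    exact ⟨M, hM⟩
  have hvn : ‖v‖ = 1 := by simp [hv]
  have hlb : ∀ x, |lineDeriv ℝ φ x v| ≤ C := fun x => by
    have := norm_lineDeriv_le_of_lipschitz ℝ hφ (x₀ := x) (v := v)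
    rwa [hvn, mul_one] at this
  have hhK : IntegrableOn h K := hw.locallyIntegrable.integrableOn_compact_subset hδU hKc
  have hgK : IntegrableOn (fun x => g x i) K := by
    have := hw.locallyIntegrable_grad.integrableOn_compact_subset hδU hKc
    exact (EuclideanSpace.proj (𝕜 := ℝ) i).integrable_comp this
  have hKm : MeasurableSet K := Metric.isClosed_cthickening.measurableSet
  have hUm := hU.measurableSet
  have toK : ∀ (a b : EuclideanSpace ℝ (Fin n) → ℝ), Function.support b ⊆ K →
      ∫ x in U, a x * b x = ∫ x in K, a x * b x := fun a b hb => by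
    refine setIntegral_eq_of_subset_of_forall_sdiff_eq_zero hUm hδU fun x hx => ?_
    rw [Function.notMem_support.1 fun h => hx.2 (hb h), mul_zero]
  -- The bounded ratio of outer to inner radius is what gives almost everywhere convergence of the
  -- mollifications.
  have hrat : ∀ᶠ k in Filter.atTop, (ψ k).rOut ≤ 2 * (ψ k).rIn :=
    Filter.Eventually.of_forall fun k => le_of_eq (by simp only [ψ]; ring)
  have hlim1 := ContDiffBump.ae_convolution_tendsto_right_of_locallyIntegrable (μ := volume) hψlim
    hrat (hφ.locallyIntegrable_lineDeriv v)
  have hlim2 := ContDiffBump.ae_convolution_tendsto_right_of_locallyIntegrable (μ := volume) hψlim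
    hrat hφ.continuous.locallyIntegrable
  have T1 : Filter.Tendsto (fun k => ∫ x in K, h x * fderiv ℝ (φk k) x v) Filter.atTop
      (nhds (∫ x in K, h x * lineDeriv ℝ φ x v)) := by
    refine tendsto_integral_of_dominated_convergence (fun x => ‖h x‖ * C) (fun k => ?_)
      (hhK.norm.mul_const _) (fun k => Filter.Eventually.of_forall fun x => ?_) ?_
    · exact hhK.aestronglyMeasurable.mul
        (((hcd k).continuous_fderiv (by simp)).clm_apply continuous_const).aestronglyMeasurable
    · rw [norm_mul, fderiv_normed_convolution _ hφ]
      exact mul_le_mul_of_nonneg_left (abs_normed_convolution_le _ hlb x) (norm_nonneg _)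
    · filter_upwards [ae_restrict_of_ae hlim1] with x hx
      refine Filter.Tendsto.const_mul _ (hx.congr fun k => ?_)
      exact (fderiv_normed_convolution _ hφ x v).symm
  have T2 : Filter.Tendsto (fun k => ∫ x in K, g x i * φk k x) Filter.atTop
      (nhds (∫ x in K, g x i * φ x)) := by
    refine tendsto_integral_of_dominated_convergence (fun x => ‖g x i‖ * M) (fun k => ?_)
      (hgK.norm.mul_const _) (fun k => Filter.Eventually.of_forall fun x => ?_) ?_
    · exact hgK.aestronglyMeasurable.mul (hcd k).continuous.aestronglyMeasurable
    · rw [norm_mul]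
      exact mul_le_mul_of_nonneg_left (abs_normed_convolution_le _ hM x) (norm_nonneg _)
    · filter_upwards [ae_restrict_of_ae hlim2] with x hx
      exact Filter.Tendsto.const_mul _ hx
  rw [toK _ _ (hlsupp.trans (Metric.self_subset_cthickening _)),
    toK (fun x => g x i) φ ((subset_tsupport φ).trans (Metric.self_subset_cthickening _))]
  refine tendsto_nhds_unique T1 (T2.neg.congr fun k => ?_)
  rw [← toK (fun x => g x i) _ ((subset_tsupport _).trans (hts k)), ← heq k, toK]
  intro x hx
  refine hsupp k (fun y => lineDeriv ℝ φ y v) hlsupp ?_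
  rw [Function.mem_support, ← fderiv_normed_convolution _ hφ]
  exact hx

end Mollification
end DiffuseDomain

/-! ### Integration by parts along the normal field. -/

namespace DiffuseDomain

/-- A bounded Lipschitz vector field `V` which is the gradient of the oriented distance, and a unit
vector, on the tube of radius `δ`. -/
structure IsNormalField {n : ℕ} (D : Set (EuclideanSpace ℝ (Fin n))) (δ : ℝ) (L : ℝ≥0)
    (V : EuclideanSpace ℝ (Fin n) → EuclideanSpace ℝ (Fin n)) : Prop where
  lipschitz : ∀ i, LipschitzWith L (fun x => V x i)
  abs_le_one : ∀ x i, |V x i| ≤ 1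
  norm_eq_one : ∀ x, |orientedDist D x| < δ → ‖V x‖ = 1
  hasFDerivAt : ∀ x, |orientedDist D x| < δ → HasFDerivAt (orientedDist D) (innerSL ℝ (V x)) x

/-- The divergence of a Lipschitz vector field, defined almost everywhere. -/
noncomputable def fieldDiv {n : ℕ} (V : EuclideanSpace ℝ (Fin n) → EuclideanSpace ℝ (Fin n))
    (x : EuclideanSpace ℝ (Fin n)) : ℝ :=
  ∑ i, lineDeriv ℝ (fun y => V y i) x (EuclideanSpace.single i 1)

variable {n : ℕ} {D : Set (EuclideanSpace ℝ (Fin n))} {δ : ℝ} {L : ℝ≥0}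
  {V : EuclideanSpace ℝ (Fin n) → EuclideanSpace ℝ (Fin n)}

lemma continuous_orientedDist : Continuous (orientedDist D) :=
  lipschitzWith_orientedDist.continuous

lemma IsNormalField.abs_fieldDiv_le (hV : IsNormalField D δ L V) (x : EuclideanSpace ℝ (Fin n)) :
    |fieldDiv V x| ≤ n * L := by
  refine (Finset.abs_sum_le_sum_abs _ _).trans ?_
  have : ∀ i ∈ Finset.univ,
      |lineDeriv ℝ (fun y => V y i) x (EuclideanSpace.single i 1)| ≤ (L : ℝ) := fun i _ => by
    simpa using norm_lineDeriv_le_of_lipschitz ℝ (hV.lipschitz i) (x₀ := x)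
      (v := EuclideanSpace.single i (1 : ℝ))
  simpa using Finset.sum_le_sum this

lemma IsNormalField.measurable_fieldDiv (hV : IsNormalField D δ L V) :
    Measurable (fieldDiv V) :=
  Finset.measurable_fun_sum _ fun i _ => measurable_lineDeriv (hV.lipschitz i).continuous

/-- The function |d - t| is Lipschitz, hence differentiable almost everywhere, and it is minimal on
{d = t}. At a point of differentiability there its derivative vanishes, so that of d does too,
against ‖∇d‖ = 1. -/
lemma IsNormalField.volume_levelSet (hV : IsNormalField D δ L V) {t : ℝ} (ht : |t| < δ) :
    volume {x | orientedDist D x = t} = 0 := by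
  have hlip : LipschitzWith 1 (fun x => |orientedDist D x - t|) := by
    refine LipschitzWith.of_dist_le_mul fun x y => ?_
    have := (lipschitzWith_orientedDist (D := D)).dist_le_mul x y
    refine le_trans ?_ this
    rw [Real.dist_eq, Real.dist_eq]
    refine (abs_abs_sub_abs_le_abs_sub _ _).trans (le_of_eq ?_)
    ring_nf
  suffices H : ∀ᵐ x, ¬ orientedDist D x = t by simpa [ae_iff] using H
  filter_upwards [hlip.ae_differentiableAt (μ := volume)] with x hx hxt
  have hmin : IsLocalMin (fun x => |orientedDist D x - t|) x :=
    Filter.Eventually.of_forall fun z => by simp [hxt]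
  have h0 := hx.hasFDerivAt
  rw [hmin.fderiv_eq_zero, hasFDerivAt_iff_isLittleO] at h0
  have h1 : HasFDerivAt (orientedDist D) (0 : EuclideanSpace ℝ (Fin n) →L[ℝ] ℝ) x := by
    rw [hasFDerivAt_iff_isLittleO]
    refine Asymptotics.IsBigO.trans_isLittleO ?_ h0
    refine Asymptotics.IsBigO.of_bound 1 (Filter.Eventually.of_forall fun z => ?_)
    simp [hxt]
  have hx' : |orientedDist D x| < δ := by rwa [hxt]
  have h2 := (hV.hasFDerivAt x hx').unique h1
  have h3 : ⟪V x, V x⟫ = 0 := by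
    have := congrArg (fun A : EuclideanSpace ℝ (Fin n) →L[ℝ] ℝ => A (V x)) h2
    simpa using this
  rw [real_inner_self_eq_norm_sq, hV.norm_eq_one x hx'] at h3
  norm_num at h3

lemma _root_.LipschitzWith.mul_of_abs_le {X : Type*} [PseudoMetricSpace X] {f g : X → ℝ} {A B K M : ℝ≥0}
    (hf : LipschitzWith K f) (hg : LipschitzWith M g) (hA : ∀ x, |f x| ≤ A) (hB : ∀ x, |g x| ≤ B) :
    LipschitzWith (A * M + B * K) (fun x => f x * g x) := by
  refine LipschitzWith.of_dist_le_mul fun x y => ?_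
  have h1 := hf.dist_le_mul x y
  have h2 := hg.dist_le_mul x y
  rw [Real.dist_eq] at *
  calc |f x * g x - f y * g y| = |f x * (g x - g y) + g y * (f x - f y)| := by ring_nf
    _ ≤ |f x| * |g x - g y| + |g y| * |f x - f y| := by
      rw [← abs_mul, ← abs_mul]; exact abs_add_le _ _
    _ ≤ A * (M * dist x y) + B * (K * dist x y) := by
      gcongr
      · exact hA x
      · exact hB y
    _ = _ := by push_cast; ring

lemma isCompact_abs_orientedDist_le (hb : Bornology.IsBounded D) (hne : D.Nonempty) (τ : ℝ) :
    IsCompact {x | |orientedDist D x| ≤ τ} := by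
  refine Metric.isCompact_of_isClosed_isBounded
    (isClosed_le continuous_orientedDist.abs continuous_const) ?_
  refine (hb.thickening (δ := max τ 0 + 1)).subset fun x hx => ?_
  rw [Metric.mem_thickening_iff_infDist_lt hne]
  by_cases hxD : x ∈ D
  · rw [Metric.infDist_zero_of_mem hxD]
    positivity
  · have h1 : orientedDist D x ≤ τ := (le_abs_self _).trans hx
    rw [orientedDist_of_notMem hxD] at h1
    linarith [le_max_left τ 0]

lemma integrableOn_mul_of_bound {U K : Set (EuclideanSpace ℝ (Fin n))}
    {f b : EuclideanSpace ℝ (Fin n) → ℝ} (hf : IntegrableOn f K) (hU : MeasurableSet U)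
    (hb : Measurable b) {M : ℝ} (hM : ∀ x, |b x| ≤ M) (h0 : ∀ x, x ∉ K → b x = 0) :
    IntegrableOn (fun x => f x * b x) U := by
  have h1 : IntegrableOn (fun x => f x * b x) K := by
    refine Integrable.mono' (hf.norm.mul_const M)
      (hf.aestronglyMeasurable.mul hb.aestronglyMeasurable)
      (Filter.Eventually.of_forall fun x => ?_)
    rw [norm_mul]
    exact mul_le_mul_of_nonneg_left (hM x) (norm_nonneg _)
  exact h1.of_forall_sdiff_eq_zero hU fun x hx => by rw [h0 x hx.2, mul_zero]

/-- Integration by parts along the normal field: `∫ h G'(d) = -∫ G(d) (∇h · V + h div V)`. -/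
theorem IsNormalField.integral_mul_deriv_comp (hV : IsNormalField D δ L V)
    (hb : Bornology.IsBounded D) (hne : D.Nonempty)
    {U : Set (EuclideanSpace ℝ (Fin n))} (hU : IsOpen U)
    {h : EuclideanSpace ℝ (Fin n) → ℝ} {g : EuclideanSpace ℝ (Fin n) → EuclideanSpace ℝ (Fin n)}
    (hw : IsWeakGradient U h g) {G : ℝ → ℝ} {C : ℝ≥0} (hG : LipschitzWith C G) {τ : ℝ}
    (hτδ : τ < δ) (hG0 : ∀ t, τ ≤ |t| → G t = 0)
    (hsub : {x | |orientedDist D x| ≤ τ} ⊆ U) {Z : Set ℝ} (hZ : Z.Finite)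
    (hdiff : ∀ t ∉ Z, DifferentiableAt ℝ G t) :
    ∫ x in U, h x * deriv G (orientedDist D x) =
      -∫ x in U, G (orientedDist D x) * (∑ i, g x i * V x i + h x * fieldDiv V x) := by
  set d := orientedDist D with hd
  set K := {x | |d x| ≤ τ} with hK
  have hKc : IsCompact K := isCompact_abs_orientedDist_le hb hne τ
  have hdc : Continuous d := continuous_orientedDist
  have hGd : LipschitzWith C (fun x => G (d x)) := by
    have := hG.comp (lipschitzWith_orientedDist (D := D))
    rwa [mul_one] at this
  have hGK : ∀ x, x ∉ K → G (d x) = 0 := fun x hx => hG0 _ (not_le.1 hx).le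
  have hcs : HasCompactSupport (fun x => G (d x)) :=
    HasCompactSupport.intro hKc hGK
  obtain ⟨M, hM⟩ : ∃ M : ℝ≥0, ∀ x, |G (d x)| ≤ M := by
    obtain ⟨M, hM⟩ := hGd.continuous.bounded_above_of_compact_support hcs
    exact ⟨M.toNNReal, fun x => (hM x).trans (Real.le_coe_toNNReal M)⟩
  have hφlip : ∀ i, LipschitzWith (M * L + 1 * C) (fun x => G (d x) * V x i) := fun i =>
    hGd.mul_of_abs_le (hV.lipschitz i) hM (fun x => by simpa using hV.abs_le_one x i)
  have hφK : ∀ i x, x ∉ K → G (d x) * V x i = 0 := fun i x hx => by rw [hGK x hx, zero_mul]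
  have hφcs : ∀ i, HasCompactSupport (fun x => G (d x) * V x i) := fun i =>
    HasCompactSupport.intro hKc (hφK i)
  have hφts : ∀ i, tsupport (fun x => G (d x) * V x i) ⊆ K := fun i =>
    closure_minimal (fun x hx => by by_contra h; exact hx (hφK i x h)) hKc.isClosed
  have hdG0 : ∀ t, τ < |t| → deriv G t = 0 := fun t ht => by
    have : G =ᶠ[nhds t] fun _ => 0 := by
      filter_upwards [(isOpen_lt continuous_const continuous_abs).mem_nhds ht] with s hs
      exact hG0 s (le_of_lt hs)
    rw [this.deriv_eq, deriv_const]
  have hφld0 : ∀ i x v, x ∉ K → lineDeriv ℝ (fun x => G (d x) * V x i) x v = 0 := fun i x v hx => by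
    have h0 : (fun x => G (d x) * V x i) =ᶠ[nhds x] fun _ => 0 :=
      notMem_tsupport_iff_eventuallyEq.1 fun h => hx (hφts i h)
    exact h0.lineDeriv_eq.trans (by simp [lineDeriv])
  -- The product rule div(G(d)V) = G'(d)‖V‖² + G(d) div V. It holds almost everywhere, because V is
  -- differentiable almost everywhere and d avoids the finitely many exceptional points of G off a
  -- null set. Outside K every term vanishes.
  have hae : ∀ᵐ x, ∑ i, lineDeriv ℝ (fun x => G (d x) * V x i) x (EuclideanSpace.single i 1) =
      deriv G (d x) + G (d x) * fieldDiv V x := by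
    have h1 : ∀ᵐ x, ∀ i, DifferentiableAt ℝ (fun x => V x i) x :=
      ae_all_iff.2 fun i => (hV.lipschitz i).ae_differentiableAt
    have h2 : ∀ᵐ x, ∀ t ∈ Z, |t| < δ → d x ≠ t := by
      refine (ae_ball_iff hZ.countable).2 fun t _ => ?_
      by_cases ht : |t| < δ
      · have := hV.volume_levelSet ht
        rw [← compl_mem_ae_iff] at this
        filter_upwards [this] with x hx _
        exact hx
      · exact Filter.Eventually.of_forall fun x h => absurd h ht
    filter_upwards [h1, h2] with x hx1 hx2
    by_cases hxK : x ∈ K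
    · have hxδ : |d x| < δ := lt_of_le_of_lt hxK hτδ
      have hGt : DifferentiableAt ℝ G (d x) := by
        refine hdiff _ fun hmem => hx2 _ hmem hxδ rfl
      have hcomp := hGt.hasDerivAt.comp_hasFDerivAt x (hV.hasFDerivAt x hxδ)
      have hterm : ∀ i, lineDeriv ℝ (fun x => G (d x) * V x i) x (EuclideanSpace.single i 1) =
          G (d x) * lineDeriv ℝ (fun x => V x i) x (EuclideanSpace.single i 1) +
            deriv G (d x) * (V x i * V x i) := fun i => by
        have hm := hcomp.mul (hx1 i).hasFDerivAt
        rw [(hx1 i).lineDeriv_eq_fderiv]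
        have : lineDeriv ℝ (fun x => G (d x) * V x i) x (EuclideanSpace.single i 1) = _ :=
          (hm.hasLineDerivAt (EuclideanSpace.single i 1)).lineDeriv
        rw [this]
        simp [EuclideanSpace.inner_single_right]
        ring
      rw [Finset.sum_congr rfl fun i _ => hterm i, Finset.sum_add_distrib, ← Finset.mul_sum,
        ← Finset.mul_sum]
      have hone : ∑ i, V x i * V x i = 1 := by
        have h3 := EuclideanSpace.real_norm_sq_eq (V x)
        rw [hV.norm_eq_one x hxδ] at h3
        rw [Finset.sum_congr rfl fun i _ => (sq (V x i)).symm, ← h3]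
        norm_num
      rw [hone, fieldDiv]
      ring
    · rw [hdG0 _ (not_le.1 hxK), hGK x hxK, Finset.sum_eq_zero fun i _ => hφld0 i x _ hxK]
      simp
  have hhK : IntegrableOn h K := hw.locallyIntegrable.integrableOn_compact_subset hsub hKc
  have hgK : ∀ i, IntegrableOn (fun x => g x i) K := fun i => by
    have := hw.locallyIntegrable_grad.integrableOn_compact_subset hsub hKc
    exact (EuclideanSpace.proj (𝕜 := ℝ) i).integrable_comp this
  have hUm := hU.measurableSet
  have I1 : ∀ i, IntegrableOn (fun x => h x *
      lineDeriv ℝ (fun x => G (d x) * V x i) x (EuclideanSpace.single i 1)) U := fun i =>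
    integrableOn_mul_of_bound hhK hUm (measurable_lineDeriv (hφlip i).continuous)
      (fun x => norm_lineDeriv_le_of_lipschitz ℝ (hφlip i) (x₀ := x) |>.trans
        (by rw [PiLp.norm_single])) fun x hx => hφld0 i x _ hx
  have I2 : ∀ i, IntegrableOn (fun x => g x i * (G (d x) * V x i)) U := fun i =>
    integrableOn_mul_of_bound (hgK i) hUm (hφlip i).continuous.measurable
      (fun x => by
        rw [abs_mul]
        exact mul_le_mul (hM x) (hV.abs_le_one x i) (abs_nonneg _) M.2) (hφK i)
  have I3 : IntegrableOn (fun x => h x * deriv G (d x)) U :=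
    integrableOn_mul_of_bound hhK hUm ((measurable_deriv G).comp hdc.measurable)
      (fun x => norm_deriv_le_of_lipschitz hG) fun x hx => hdG0 _ (not_le.1 hx)
  have I4 : IntegrableOn (fun x => h x * (G (d x) * fieldDiv V x)) U :=
    integrableOn_mul_of_bound hhK hUm (hGd.continuous.measurable.mul hV.measurable_fieldDiv)
      (fun x => by
        rw [abs_mul]
        exact mul_le_mul (hM x) (hV.abs_fieldDiv_le x) (abs_nonneg _) M.2)
      fun x hx => by simp only [hGK x hx, zero_mul]
  have key : ∀ i, _ := fun i => hw.integral_mul_lineDeriv hU (hφlip i) (hφcs i)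
    ((hφts i).trans hsub) i
  have hsum := Finset.sum_congr (rfl : (Finset.univ : Finset (Fin n)) = _) fun i _ => key i
  rw [← integral_finsetSum _ fun i _ => I1 i, Finset.sum_neg_distrib,
    ← integral_finsetSum _ fun i _ => I2 i] at hsum
  have e1 : ∫ x in U, ∑ i, h x *
      lineDeriv ℝ (fun x => G (d x) * V x i) x (EuclideanSpace.single i 1) =
      (∫ x in U, h x * deriv G (d x)) + ∫ x in U, h x * (G (d x) * fieldDiv V x) := by
    rw [← integral_add I3 I4]
    refine integral_congr_ae ?_
    filter_upwards [ae_restrict_of_ae hae] with x hx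
    rw [← Finset.mul_sum, hx, mul_add]
  have e2 : ∫ x in U, G (d x) * (∑ i, g x i * V x i + h x * fieldDiv V x) =
      (∫ x in U, ∑ i, g x i * (G (d x) * V x i)) + ∫ x in U, h x * (G (d x) * fieldDiv V x) := by
    rw [← integral_add (integrable_finsetSum _ fun i _ => I2 i) I4]
    refine integral_congr_ae (Filter.Eventually.of_forall fun x => ?_)
    simp only [mul_add, Finset.mul_sum]
    congr 1
    · exact Finset.sum_congr rfl fun i _ => by ring
    · ring
  rw [e2]
  rw [e1] at hsum
  linarith
end DiffuseDomain

/-! ### One-dimensional profiles and their cut-off primitives. -/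

namespace DiffuseDomain

/-- S is absolutely continuous, being Lipschitz, and its derivative is nonnegative almost
everywhere; integrate it. -/
lemma IsSigmoidal.monotone {S : ℝ → ℝ} (hS : IsSigmoidal S) : Monotone S := by
  obtain ⟨K, hK⟩ := hS.lipschitz
  have hderiv : ∀ᵐ t : ℝ, 0 ≤ deriv S t := by
    have h1 : ∀ᵐ t : ℝ, t ≠ 1 := by simp [ae_iff]
    have h2 : ∀ᵐ t : ℝ, t ≠ -1 := by simp [ae_iff]
    filter_upwards [hS.deriv_pos, h1, h2] with t ht ht1 ht2
    rcases lt_trichotomy |t| 1 with h | h | h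
    · exact (ht h).2.le
    · rcases eq_or_eq_neg_of_abs_eq h with h | h
      · exact absurd h ht1
      · exact absurd h ht2
    · have hc : S =ᶠ[nhds t] fun _ => t / |t| := by
        rcases lt_or_ge t 0 with h0 | h0
        · rw [abs_of_neg h0] at h ⊢
          filter_upwards [Iio_mem_nhds (show t < -1 by linarith)] with s hs
          have hs' : s < -1 := hs
          have hs0 : s < 0 := by linarith
          rw [hS.eq_sign s (by rw [abs_of_neg hs0]; linarith), abs_of_neg hs0, div_neg, div_neg,
            div_self hs0.ne, div_self h0.ne]
        · rw [abs_of_nonneg h0] at h ⊢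
          filter_upwards [Ioi_mem_nhds h] with s hs
          have hs' : 1 < s := hs
          have hs0 : 0 < s := by linarith
          rw [hS.eq_sign s (by rw [abs_of_pos hs0]; exact hs'.le), abs_of_pos hs0,
            div_self hs0.ne', div_self (by linarith)]
      rw [hc.deriv_eq, deriv_const]
  intro a b hab
  have hac : AbsolutelyContinuousOnInterval S a b :=
    (hK.lipschitzOnWith (s := uIcc a b)).absolutelyContinuousOnInterval
  have hFTC := hac.integral_deriv_eq_sub
  have : 0 ≤ ∫ t in a..b, deriv S t :=
    intervalIntegral.integral_nonneg_of_ae hab hderiv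
  linarith

/-- The one-dimensional profiles of the phase fields of width `ε`. -/
structure IsProfile (w : ℝ → ℝ) (ε : ℝ) : Prop where
  continuous : Continuous w
  antitone : Antitone w
  eq_zero : ∀ t, ε ≤ t → w t = 0
  symm : ∀ t, w (-t) = 1 - w t

lemma IsSigmoidal.isProfile {S : ℝ → ℝ} (hS : IsSigmoidal S) {ε : ℝ} (hε : 0 < ε) :
    IsProfile (fun t => (1 + S (-t / ε)) / 2) ε := by
  obtain ⟨K, hK⟩ := hS.lipschitz
  refine ⟨?_, fun s t hst => ?_, fun t ht => ?_, fun t => ?_⟩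
  · have := hK.continuous
    fun_prop
  · have : S (-t / ε) ≤ S (-s / ε) := hS.monotone (by gcongr)
    linarith
  · have h1 : 1 ≤ t / ε := by rwa [one_le_div hε]
    have h0 : -t / ε < 0 := by rw [neg_div]; linarith
    have : S (-t / ε) = -1 := by
      rw [hS.eq_sign _ (by rw [neg_div, abs_neg]; exact h1.trans (le_abs_self _)),
        abs_of_neg h0, div_neg, div_self h0.ne]
    simp [this]
  · have := hS.odd (-t / ε)
    rw [show - -t / ε = -(-t / ε) by ring]
    linarith

namespace IsProfile

variable {w : ℝ → ℝ} {ε : ℝ}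

lemma nonneg (hw : IsProfile w ε) (t : ℝ) : 0 ≤ w t := by
  rw [← hw.eq_zero (max t ε) (le_max_right _ _)]
  exact hw.antitone (le_max_left _ _)

lemma le_one (hw : IsProfile w ε) (t : ℝ) : w t ≤ 1 := by
  have := hw.nonneg (-t)
  rw [hw.symm] at this
  linarith

lemma half_le (hw : IsProfile w ε) {t : ℝ} (ht : t ≤ 0) : 1 / 2 ≤ w t := by
  have h1 := hw.symm t
  have h2 := hw.antitone (show t ≤ -t by linarith)
  linarith

lemma eq_one (hw : IsProfile w ε) {t : ℝ} (ht : t ≤ -ε) : w t = 1 := by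
  have h1 := hw.symm t
  rw [hw.eq_zero (-t) (by linarith)] at h1
  linarith

/-- The deviation of a profile from the indicator function of the negative half-line. -/
lemma abs_sub_le (hw : IsProfile w ε) (t : ℝ) : |w t - if t < 0 then 1 else 0| ≤ w t := by
  have h0 := hw.nonneg t
  split_ifs with h
  · have h1 := hw.half_le h.le
    have h2 := hw.le_one t
    rw [abs_le]; constructor <;> linarith
  · rw [sub_zero, abs_of_nonneg h0]

/-- A primitive of `1_{t < 0} - w`, cut off at `|t| = τ`. -/
noncomputable def _root_.DiffuseDomain.cutPrimitive (w : ℝ → ℝ) (τ t : ℝ) : ℝ :=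
  ∫ s in (min |t| τ)..τ, w s

lemma hasDerivAt_integral (hw : IsProfile w ε) (τ a : ℝ) :
    HasDerivAt (fun a => ∫ s in a..τ, w s) (-w a) a :=
  intervalIntegral.integral_hasDerivAt_left (hw.continuous.intervalIntegrable _ _)
    (hw.continuous.stronglyMeasurableAtFilter _ _) hw.continuous.continuousAt

lemma lipschitzWith_cutPrimitive (hw : IsProfile w ε) (τ : ℝ) :
    LipschitzWith 1 (cutPrimitive w τ) := by
  have h1 : LipschitzWith 1 (fun a => ∫ s in a..τ, w s) := by
    refine lipschitzWith_of_nnnorm_deriv_le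
      (fun a => (hw.hasDerivAt_integral τ a).differentiableAt) fun a => ?_
    rw [(hw.hasDerivAt_integral τ a).deriv, nnnorm_neg, ← NNReal.coe_le_coe, coe_nnnorm,
      Real.norm_of_nonneg (hw.nonneg a)]
    exact hw.le_one a
  have h2 : LipschitzWith 1 (fun t : ℝ => min |t| τ) :=
    (lipschitzWith_one_norm (E := ℝ)).min_const τ
  have := h1.comp h2
  rwa [mul_one] at this

lemma cutPrimitive_eq_zero (w : ℝ → ℝ) {τ t : ℝ} (ht : τ ≤ |t|) : cutPrimitive w τ t = 0 := by
  rw [cutPrimitive, min_eq_right ht, intervalIntegral.integral_same]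

lemma cutPrimitive_nonneg (hw : IsProfile w ε) (τ t : ℝ) : 0 ≤ cutPrimitive w τ t :=
  intervalIntegral.integral_nonneg (min_le_right _ _) fun s _ => hw.nonneg s

/-- On the interval of integration s ≥ |t| ≥ t, so w s ≤ w t, and the interval is no longer than ε.
Bounding by w t, and not by 1, is what keeps the estimate in the weighted norm. -/
lemma cutPrimitive_le (hw : IsProfile w ε) {τ : ℝ} (hτ : 0 < τ) (hτε : τ ≤ ε) (t : ℝ) :
    cutPrimitive w τ t ≤ ε * w t := by
  have hε : 0 ≤ ε := hτ.le.trans hτε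
  rcases le_or_gt τ |t| with h | h
  · rw [cutPrimitive_eq_zero w h]
    exact mul_nonneg hε (hw.nonneg t)
  · rw [cutPrimitive, min_eq_left h.le]
    have h1 : ∫ s in |t|..τ, w s ≤ ∫ _ in |t|..τ, w t :=
      intervalIntegral.integral_mono_on h.le (hw.continuous.intervalIntegrable _ _)
        intervalIntegrable_const fun s hs => hw.antitone ((le_abs_self t).trans hs.1)
    rw [intervalIntegral.integral_const, smul_eq_mul] at h1
    refine h1.trans (mul_le_mul_of_nonneg_right ?_ (hw.nonneg t))
    linarith [abs_nonneg t]

/-- For t < 0 the derivative of the even function is w |t| = w (-t) = 1 - w t by symmetry of the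
profile; for t > 0 it is -w t. -/
lemma hasDerivAt_cutPrimitive (hw : IsProfile w ε) {τ t : ℝ} (ht0 : t ≠ 0) (ht : |t| < τ) :
    HasDerivAt (cutPrimitive w τ) ((if t < 0 then 1 else 0) - w t) t := by
  have hev : cutPrimitive w τ =ᶠ[nhds t] fun s => ∫ r in |s|..τ, w r := by
    filter_upwards [(isOpen_lt continuous_abs continuous_const).mem_nhds ht] with s hs
    rw [cutPrimitive, min_eq_left (le_of_lt hs)]
  refine HasDerivAt.congr_of_eventuallyEq ?_ hev
  have h := (hw.hasDerivAt_integral τ |t|).comp t (hasDerivAt_abs ht0)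
  have hval : (if t < 0 then 1 else 0) - w t = -w |t| * (SignType.sign t : ℝ) := by
    rcases lt_or_gt_of_ne ht0 with h0 | h0
    · rw [if_pos h0, sign_neg h0, abs_of_neg h0, hw.symm]
      simp
    · rw [if_neg h0.le.not_gt, sign_pos h0, abs_of_pos h0]
      simp
  rw [hval]
  exact h

lemma hasDerivAt_cutPrimitive_of_lt (w : ℝ → ℝ) {τ t : ℝ} (ht : τ < |t|) :
    HasDerivAt (cutPrimitive w τ) 0 t := by
  have hev : cutPrimitive w τ =ᶠ[nhds t] fun _ => 0 := by
    filter_upwards [(isOpen_lt continuous_const continuous_abs).mem_nhds ht] with s hs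
    exact cutPrimitive_eq_zero w (le_of_lt hs)
  exact (hasDerivAt_const t (0 : ℝ)).congr_of_eventuallyEq hev

end IsProfile
end DiffuseDomain

/-! ### The volume of the tube and the main estimate. -/

namespace DiffuseDomain

variable {n : ℕ} {D : Set (EuclideanSpace ℝ (Fin n))} {δ : ℝ} {L : ℝ≥0}
  {V : EuclideanSpace ℝ (Fin n) → EuclideanSpace ℝ (Fin n)}

/-- This allows the integration by parts with h = 1, which yields the volume of the tube. -/
lemma isWeakGradient_one :
    IsWeakGradient (univ : Set (EuclideanSpace ℝ (Fin n))) (fun _ => 1) (fun _ => 0) := by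
  refine ⟨locallyIntegrableOn_const _, locallyIntegrableOn_const _, fun φ hφ hc _ i => ?_⟩
  obtain ⟨K, hK⟩ := hφ.lipschitzWith_of_hasCompactSupport hc (by simp)
  have h := LipschitzWith.integral_lineDeriv_mul_eq (μ := volume)
    (LipschitzWith.const (1 : ℝ)) hK hc (-EuclideanSpace.single i (1 : ℝ))
  have hd : ∀ x, lineDeriv ℝ φ x (EuclideanSpace.single i 1) =
      fderiv ℝ φ x (EuclideanSpace.single i 1) := fun x =>
    (hφ.differentiable (by simp) x).lineDeriv_eq_fderiv
  have h0 : ∀ x v : EuclideanSpace ℝ (Fin n),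
      lineDeriv ℝ (fun _ : EuclideanSpace ℝ (Fin n) => (1 : ℝ)) x v = 0 := fun x v => by
    simp [lineDeriv]
  simp only [h0, neg_neg, hd, zero_mul, mul_one, integral_zero] at h
  simp [← h]

/-- The truncation of the identity at height `t`. -/
noncomputable def clamp (t s : ℝ) : ℝ := max (min s t) (-t)

lemma lipschitzWith_clamp (t : ℝ) : LipschitzWith 1 (clamp t) :=
  (LipschitzWith.id.min_const t).max_const (-t)

lemma abs_clamp_le {t : ℝ} (ht : 0 ≤ t) (s : ℝ) : |clamp t s| ≤ t :=
  abs_le.2 ⟨le_max_right _ _, max_le (min_le_right _ _) (by linarith)⟩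

lemma clamp_of_abs_le {t s : ℝ} (h : |s| ≤ t) : clamp t s = s := by
  rw [clamp, min_eq_left (abs_le.1 h).2, max_eq_left (abs_le.1 h).1]

lemma clamp_of_le {t s : ℝ} (ht : 0 ≤ t) (h : t ≤ s) : clamp t s = t := by
  rw [clamp, min_eq_right h, max_eq_left (by linarith)]

lemma clamp_of_le_neg {t s : ℝ} (ht : 0 ≤ t) (h : s ≤ -t) : clamp t s = -t := by
  rw [clamp, min_eq_left (by linarith), max_eq_right h]

lemma hasDerivAt_clamp {t s : ℝ} (ht : 0 ≤ t) (hs : |s| ≠ t) :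
    HasDerivAt (clamp t) (if |s| < t then 1 else 0) s := by
  split_ifs with h
  · refine (hasDerivAt_id s).congr_of_eventuallyEq ?_
    filter_upwards [(isOpen_lt continuous_abs continuous_const).mem_nhds h] with r hr
    exact clamp_of_abs_le (le_of_lt hr)
  · have h' : t < |s| := lt_of_le_of_ne (not_lt.1 h) hs.symm
    rcases lt_abs.1 h' with h1 | h1
    · refine (hasDerivAt_const s t).congr_of_eventuallyEq ?_
      filter_upwards [Ioi_mem_nhds h1] with r hr
      exact clamp_of_le ht (le_of_lt hr)
    · refine (hasDerivAt_const s (-t)).congr_of_eventuallyEq ?_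
      filter_upwards [Iio_mem_nhds (show s < -t by linarith)] with r hr
      exact clamp_of_le_neg ht (le_of_lt hr)

lemma finite_setOf_abs_eq (t : ℝ) : {s : ℝ | |s| = t}.Finite :=
  (Set.toFinite {t, -t}).subset fun s (hs : |s| = t) => by
    rcases abs_cases s with h | h
    · left; linarith [h.1]
    · right; rw [mem_singleton_iff]; linarith [h.1]

lemma measurableSet_abs_orientedDist_lt (t : ℝ) :
    MeasurableSet {x | |orientedDist D x| < t} :=
  (isOpen_lt continuous_orientedDist.abs continuous_const).measurableSet

lemma volume_abs_orientedDist_lt_ne_top (hb : Bornology.IsBounded D) (hne : D.Nonempty) (t : ℝ) :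
    volume {x | |orientedDist D x| < t} ≠ ⊤ :=
  ne_top_of_le_ne_top (isCompact_abs_orientedDist_le hb hne t).measure_ne_top
    (measure_mono fun _ hx => le_of_lt (mem_ofPred_eq ▸ hx))

lemma IsNormalField.ae_abs_orientedDist_ne (hV : IsNormalField D δ L V) {t : ℝ} (ht : |t| < δ) :
    ∀ᵐ x, |orientedDist D x| ≠ t := by
  have h1 := hV.volume_levelSet ht
  have h2 := hV.volume_levelSet (t := -t) (by rwa [abs_neg])
  rw [← compl_mem_ae_iff] at h1 h2
  filter_upwards [h1, h2] with x hx1 hx2 h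
  rcases abs_cases (orientedDist D x) with h' | h'
  · exact hx1 (by rw [mem_ofPred_eq]; linarith [h'.1])
  · exact hx2 (by rw [mem_ofPred_eq]; linarith [h'.1])

/-- Integrate by parts with h = 1 and G(s) = clamp_t(s) - (t/b) clamp_b(s). This G vanishes for |s|
≥ b, satisfies |G| ≤ 2t, and has G' = 1_{|s|<t} - (t/b) 1_{|s|<b}; so |{|d|<t}| - (t/b) |{|d|<b}| is
bounded by 2t · nL · |{|d|<b}|. -/
lemma IsNormalField.volume_tube_le_of_le (hV : IsNormalField D δ L V) (hb : Bornology.IsBounded D)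
    (hne : D.Nonempty) {b t : ℝ} (hbδ : b < δ) (ht : 0 < t) (htb : t ≤ b) :
    volume.real {x | |orientedDist D x| < t} ≤
      (1 / b + 2 * (n * L)) * volume.real {x | |orientedDist D x| < b} * t := by
  have hb0 : 0 < b := ht.trans_le htb
  set G : ℝ → ℝ := fun s => clamp t s - t / b * clamp b s with hG
  set d := orientedDist D with hd
  have hGlip : LipschitzWith (1 + 1) G := by
    refine (lipschitzWith_clamp t).sub ?_
    refine LipschitzWith.of_dist_le_mul fun r s => ?_
    rw [Real.dist_eq, ← mul_sub, abs_mul, abs_of_nonneg (by positivity), ← Real.dist_eq]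
    refine mul_le_mul ?_ ?_ dist_nonneg (by positivity)
    · rw [NNReal.coe_one, div_le_one hb0]; exact htb
    · simpa using (lipschitzWith_clamp b).dist_le_mul r s
  have hG0 : ∀ s, b ≤ |s| → G s = 0 := fun s hs => by
    rcases le_abs.1 hs with h | h
    · simp only [hG, clamp_of_le ht.le (htb.trans h), clamp_of_le hb0.le h]
      field_simp; ring
    · simp only [hG, clamp_of_le_neg ht.le (show s ≤ -t by linarith),
        clamp_of_le_neg hb0.le (show s ≤ -b by linarith)]
      field_simp; ring
  have hGb : ∀ s, |G s| ≤ 2 * t := fun s => by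
    have h1 := abs_clamp_le ht.le s
    have h2 : |t / b * clamp b s| ≤ t := by
      rw [abs_mul, abs_of_pos (by positivity)]
      calc t / b * |clamp b s| ≤ t / b * b := by gcongr; exact abs_clamp_le hb0.le s
        _ = t := by field_simp
    calc |G s| ≤ |clamp t s| + |t / b * clamp b s| := abs_sub _ _
      _ ≤ 2 * t := by linarith
  have hGd : ∀ s, |s| ≠ t → |s| ≠ b →
      HasDerivAt G ((if |s| < t then 1 else 0) - t / b * (if |s| < b then 1 else 0)) s :=
    fun s h1 h2 => (hasDerivAt_clamp ht.le h1).sub ((hasDerivAt_clamp hb0.le h2).const_mul _)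
  have key := hV.integral_mul_deriv_comp hb hne isOpen_univ isWeakGradient_one hGlip hbδ hG0
    (subset_univ _) ((finite_setOf_abs_eq t).union (finite_setOf_abs_eq b)) fun s hs => by
      rw [mem_union, not_or] at hs
      exact (hGd s hs.1 hs.2).differentiableAt
  simp only [Measure.restrict_univ, one_mul, PiLp.zero_apply, zero_mul, Finset.sum_const_zero,
    zero_add] at key
  have hmt := measurableSet_abs_orientedDist_lt (D := D) t
  have hmb := measurableSet_abs_orientedDist_lt (D := D) b
  have hft := volume_abs_orientedDist_lt_ne_top hb hne t
  have hfb := volume_abs_orientedDist_lt_ne_top hb hne b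
  rw [← hd] at hmt hmb hft hfb
  simp only [← hd] at key
  have hl : ∫ x, deriv G (d x) =
      volume.real {x | |d x| < t} - t / b * volume.real {x | |d x| < b} := by
    have h1 : ∫ x, deriv G (d x) = ∫ x, ({x | |d x| < t}.indicator (fun _ => (1 : ℝ)) x -
        t / b * {x | |d x| < b}.indicator (fun _ => (1 : ℝ)) x) := by
      refine integral_congr_ae ?_
      filter_upwards [hV.ae_abs_orientedDist_ne (t := t) (by rw [abs_of_pos ht]; linarith),
        hV.ae_abs_orientedDist_ne (t := b) (by rwa [abs_of_pos hb0])] with x hx1 hx2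
      rw [← hd] at hx1 hx2
      rw [(hGd _ hx1 hx2).deriv]
      simp [indicator_apply]
    rw [h1, integral_sub ((integrable_indicator_iff hmt).2 (integrableOn_const hft))
      (((integrable_indicator_iff hmb).2 (integrableOn_const hfb)).const_mul _),
      integral_const_mul, integral_indicator_const _ hmt, integral_indicator_const _ hmb]
    simp
  have hr : |∫ x, G (d x) * fieldDiv V x| ≤ 2 * t * (n * L) * volume.real {x | |d x| < b} := by
    have h1 : ∫ x, G (d x) * fieldDiv V x = ∫ x in {x | |d x| < b}, G (d x) * fieldDiv V x := by
      refine (setIntegral_eq_integral_of_forall_compl_eq_zero fun x hx => ?_).symm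
      rw [hG0 _ (not_lt.1 hx), zero_mul]
    rw [h1]
    refine (Real.norm_eq_abs _).symm.le.trans <|
      norm_setIntegral_le_of_norm_le_const (lt_top_iff_ne_top.2 hfb) fun x _ => ?_
    rw [norm_mul]
    exact mul_le_mul (hGb _) (hV.abs_fieldDiv_le x) (norm_nonneg _) (by positivity)
  rw [hl] at key
  have h2 := neg_abs_le (∫ x, G (d x) * fieldDiv V x)
  have h3 : (1 / b + 2 * (n * L)) * volume.real {x | |d x| < b} * t =
      t / b * volume.real {x | |d x| < b} + 2 * t * (n * L) * volume.real {x | |d x| < b} := by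
    ring
  rw [h3]
  linarith

/-- The volume of the tube of radius `t` around the boundary is `O(t)`. -/
theorem IsNormalField.exists_volume_tube_le (hV : IsNormalField D δ L V)
    (hb : Bornology.IsBounded D) (hne : D.Nonempty) (hδ : 0 < δ) (T : ℝ) :
    ∃ M : ℝ, 0 < M ∧ ∀ t, 0 < t → t ≤ T → volume.real {x | |orientedDist D x| < t} ≤ M * t := by
  set b := δ / 2 with hbdef
  have hb0 : 0 < b := by positivity
  set v := volume.real {x | |orientedDist D x| < b}
  set v' := volume.real {x | |orientedDist D x| < T}
  have hv : 0 ≤ v := measureReal_nonneg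
  have hv' : 0 ≤ v' := measureReal_nonneg
  -- The first term serves t ≤ b; for b < t ≤ T the volume is at most v' ≤ (v'/b) t. The 1 only
  -- ensures positivity.
  refine ⟨(1 / b + 2 * (n * L)) * v + v' / b + 1, by positivity, fun t ht htT => ?_⟩
  rcases le_or_gt t b with h | h
  · have h1 := hV.volume_tube_le_of_le hb hne (by linarith) ht h
    have h2 : 0 ≤ v' / b * t := by positivity
    linarith
  · have h1 : volume.real {x | |orientedDist D x| < t} ≤ v' :=
      measureReal_mono (fun x hx => lt_of_lt_of_le hx htT)
        (volume_abs_orientedDist_lt_ne_top hb hne T)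
    have h2 : 0 ≤ (1 / b + 2 * (n * L)) * v * t := by positivity
    have h3 : v' ≤ v' / b * t := by
      rw [div_mul_eq_mul_div, le_div_iff₀ hb0]
      gcongr
    linarith

/-- The main estimate: a phase field of width `ε` differs from the indicator function of `D`, tested
against `h`, by `ε` times the weighted `W^{1,1}` norm of `h` in the tube. -/
theorem IsNormalField.abs_integral_profile_sub_le (hV : IsNormalField D δ L V)
    (hb : Bornology.IsBounded D) (hne : D.Nonempty) {w : ℝ → ℝ} {ε : ℝ} (hw : IsProfile w ε)
    (hε : 0 < ε) (hεδ : ε ≤ δ) {h : EuclideanSpace ℝ (Fin n) → ℝ}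
    {g : EuclideanSpace ℝ (Fin n) → EuclideanSpace ℝ (Fin n)}
    (hg : IsWeakGradient (sublevel D ε) h g)
    (hih : IntegrableOn (fun x => |h x| * w (orientedDist D x)) {x | |orientedDist D x| < ε})
    (hig : IntegrableOn (fun x => ‖g x‖ * w (orientedDist D x)) {x | |orientedDist D x| < ε}) :
    |∫ x in {x | |orientedDist D x| < ε},
        h x * (w (orientedDist D x) - if orientedDist D x < 0 then 1 else 0)| ≤
      ε * (1 + n * L) * ∫ x in {x | |orientedDist D x| < ε},
        (|h x| * w (orientedDist D x) + ‖g x‖ * w (orientedDist D x)) := by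
  set d := orientedDist D with hd
  set A : ℝ → Set (EuclideanSpace ℝ (Fin n)) := fun τ => {x | |d x| < τ} with hA
  have hdc : Continuous d := continuous_orientedDist
  have hAm : ∀ τ, MeasurableSet (A τ) := fun τ => measurableSet_abs_orientedDist_lt τ
  have hU : IsOpen (sublevel D ε) := isOpen_lt hdc continuous_const
  have hAU : A ε ⊆ sublevel D ε := fun x hx => show d x < ε from (abs_lt.1 hx).2
  have hint : IntegrableOn (fun x => h x * (w (d x) - if d x < 0 then 1 else 0)) (A ε) := by
    refine hih.mono' ?_ (Filter.Eventually.of_forall fun x => ?_)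
    · refine AEStronglyMeasurable.mul ?_ ?_
      · exact (hg.locallyIntegrable.aestronglyMeasurable).mono_measure
          (Measure.restrict_mono hAU le_rfl)
      · refine Measurable.aestronglyMeasurable ?_
        exact (hw.continuous.comp hdc).measurable.sub
          (Measurable.ite (measurableSet_lt hdc.measurable measurable_const)
            measurable_const measurable_const)
    · rw [norm_mul]
      exact mul_le_mul_of_nonneg_left (hw.abs_sub_le _) (norm_nonneg _)
  have hsum : IntegrableOn (fun x => |h x| * w (d x) + ‖g x‖ * w (d x)) (A ε) := hih.add hig
  -- The cut-off is at τ < ε because {|d| ≤ τ} is then a compact subset of the open set D_ε, as the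
  -- test field requires. The bound does not depend on τ, and τ ↑ ε at the end.
  have step : ∀ τ, 0 < τ → τ < ε →
      |∫ x in A τ, h x * (w (d x) - if d x < 0 then 1 else 0)| ≤
        ε * (1 + n * L) * ∫ x in A ε, (|h x| * w (d x) + ‖g x‖ * w (d x)) := by
    intro τ hτ hτε
    have hd0 : ∀ᵐ x, d x ≠ 0 := by
      have := hV.volume_levelSet (t := 0) (by rw [abs_zero]; linarith)
      rw [← compl_mem_ae_iff] at this
      exact this
    have hdτ := hV.ae_abs_orientedDist_ne (t := τ) (by rw [abs_of_pos hτ]; linarith)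
    have key := hV.integral_mul_deriv_comp hb hne hU hg (hw.lipschitzWith_cutPrimitive τ)
      (hτε.trans_le hεδ) (fun t ht => IsProfile.cutPrimitive_eq_zero w ht)
      (fun x hx => lt_of_le_of_lt ((le_abs_self _).trans hx) hτε)
      ((finite_setOf_abs_eq τ).union (Set.finite_singleton 0)) fun t ht => by
        rw [mem_union, not_or] at ht
        rcases lt_or_gt_of_ne ht.1 with h1 | h1
        · exact (hw.hasDerivAt_cutPrimitive ht.2 h1).differentiableAt
        · exact (IsProfile.hasDerivAt_cutPrimitive_of_lt w h1).differentiableAt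
    have hl : ∫ x in sublevel D ε, h x * deriv (cutPrimitive w τ) (d x) =
        -∫ x in A τ, h x * (w (d x) - if d x < 0 then 1 else 0) := by
      rw [← integral_neg, ← integral_indicator (hAm τ), ← integral_indicator hU.measurableSet]
      refine integral_congr_ae ?_
      filter_upwards [hd0, hdτ] with x hx0 hxτ
      rcases lt_or_gt_of_ne hxτ with h1 | h1
      · rw [indicator_of_mem (show x ∈ A τ from h1),
          indicator_of_mem (hAU (show x ∈ A ε from h1.trans hτε)),
          (hw.hasDerivAt_cutPrimitive hx0 h1).deriv]
        ring
      · rw [indicator_of_notMem (show x ∉ A τ from not_lt.2 h1.le)]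
        refine indicator_apply_eq_zero.2 fun _ => ?_
        rw [(IsProfile.hasDerivAt_cutPrimitive_of_lt w h1).deriv, mul_zero]
    have hr : ∫ x in sublevel D ε,
        cutPrimitive w τ (d x) * (∑ i, g x i * V x i + h x * fieldDiv V x) =
        ∫ x in A ε, cutPrimitive w τ (d x) * (∑ i, g x i * V x i + h x * fieldDiv V x) := by
      refine setIntegral_eq_of_subset_of_forall_sdiff_eq_zero hU.measurableSet hAU fun x hx => ?_
      have : ε ≤ |d x| := not_lt.1 hx.2
      rw [IsProfile.cutPrimitive_eq_zero w (hτε.le.trans this), zero_mul]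
    rw [hl, hr, neg_inj] at key
    rw [key, ← integral_const_mul]
    refine (Real.norm_eq_abs _).symm.le.trans
      (norm_integral_le_of_norm_le (hsum.const_mul _) ?_)
    filter_upwards [ae_restrict_mem (hAm ε)] with x hx
    have hVx : ‖V x‖ = 1 := hV.norm_eq_one x (lt_of_lt_of_le hx hεδ)
    have h1 : |∑ i, g x i * V x i| ≤ ‖g x‖ := by
      have e : ∑ i, g x i * V x i = ⟪V x, g x⟫ := by
        simp [PiLp.inner_apply]
      rw [e]
      simpa [hVx] using abs_real_inner_le_norm (V x) (g x)
    have h2 : |h x * fieldDiv V x| ≤ |h x| * (n * L) := by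
      rw [abs_mul]
      exact mul_le_mul_of_nonneg_left (hV.abs_fieldDiv_le x) (abs_nonneg _)
    have h3 := hw.cutPrimitive_le hτ hτε.le (d x)
    have h4 := hw.cutPrimitive_nonneg τ (d x)
    have h5 := hw.nonneg (d x)
    rw [norm_mul, Real.norm_of_nonneg h4, Real.norm_eq_abs]
    have hnL : 0 ≤ (n : ℝ) * L := by positivity
    calc cutPrimitive w τ (d x) * |∑ i, g x i * V x i + h x * fieldDiv V x|
        ≤ (ε * w (d x)) * (‖g x‖ + |h x| * (n * L)) :=
          mul_le_mul h3 ((abs_add_le _ _).trans (add_le_add h1 h2)) (abs_nonneg _) (by positivity)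
      _ ≤ (ε * w (d x)) * ((1 + n * L) * (|h x| + ‖g x‖)) := by
          gcongr
          nlinarith [abs_nonneg (h x), mul_nonneg hnL (norm_nonneg (g x))]
      _ = ε * (1 + n * L) * (|h x| * w (d x) + ‖g x‖ * w (d x)) := by ring
  obtain ⟨τ, hτmono, hτmem, hτlim⟩ := exists_seq_strictMono_tendsto' hε
  have hUn : ⋃ k, A (τ k) = A ε := by
    ext x
    simp only [mem_iUnion, hA, mem_ofPred_eq]
    constructor
    · rintro ⟨k, hk⟩
      exact hk.trans (hτmem k).2
    · intro hx
      exact (hτlim.eventually (lt_mem_nhds hx)).exists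
  have hlim := tendsto_setIntegral_of_monotone (μ := volume)
    (f := fun x => h x * (w (d x) - if d x < 0 then 1 else 0)) (s := fun k => A (τ k))
    (fun k => hAm _) (fun k l hkl x hx => lt_of_lt_of_le hx (hτmono.monotone hkl))
    (by rw [hUn]; exact hint)
  rw [hUn] at hlim
  exact le_of_tendsto hlim.abs
    (Filter.Eventually.of_forall fun k => step (τ k) (hτmem k).1 (hτmem k).2)

end DiffuseDomain

/-! ### Weighted norms, and the error as an integral over the tube. -/

namespace DiffuseDomain

variable {n : ℕ} {D : Set (EuclideanSpace ℝ (Fin n))}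

/-- Hölder's inequality against the constant function `1`. -/
lemma integral_norm_le_eLpNorm_mul_rpow {α F : Type*} [MeasurableSpace α] [NormedAddCommGroup F]
    {μ : Measure α} {f : α → F} {p : ℝ≥0∞} (hp : 1 ≤ p) (hf : MemLp f p μ) {m : ℝ} (hm : 0 ≤ m)
    (hμ : μ univ ≤ ENNReal.ofReal m) :
    ∫ x, ‖f x‖ ∂μ ≤ (eLpNorm f p μ).toReal * m ^ (1 - (1 / p).toReal) := by
  have he : 0 ≤ 1 - (1 / p).toReal := by
    rw [sub_nonneg]
    have : (1 / p).toReal ≤ (1 : ℝ≥0∞).toReal :=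
      ENNReal.toReal_mono ENNReal.one_ne_top (by rw [one_div]; exact ENNReal.inv_le_one.2 hp)
    simpa using this
  have h1 := eLpNorm_le_eLpNorm_mul_rpow_measure_univ hp hf.1
  rw [show 1 / (1 : ℝ≥0∞).toReal - 1 / p.toReal = 1 - (1 / p).toReal by simp] at h1
  have h2 : eLpNorm f 1 μ ≤ eLpNorm f p μ * ENNReal.ofReal (m ^ (1 - (1 / p).toReal)) := by
    refine h1.trans ?_
    rw [← ENNReal.ofReal_rpow_of_nonneg hm he]
    gcongr
  have h3 := ENNReal.toReal_mono (ENNReal.mul_ne_top hf.2.ne ENNReal.ofReal_ne_top) h2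
  rw [ENNReal.toReal_mul, ENNReal.toReal_ofReal (by positivity)] at h3
  refine le_trans (le_of_eq ?_) h3
  rw [eLpNorm_one_eq_lintegral_enorm, integral_norm_eq_lintegral_enorm hf.1]

lemma eLpNorm_toReal_eq {α F : Type*} [MeasurableSpace α] [NormedAddCommGroup F]
    {μ : Measure α} {f : α → F} {p : ℝ≥0∞} (hp : 1 ≤ p) (hp' : p ≠ ⊤) (hf : MemLp f p μ) :
    (eLpNorm f p μ).toReal = (∫ x, ‖f x‖ ^ p.toReal ∂μ) ^ (1 / p.toReal) := by
  rw [hf.eLpNorm_eq_integral_rpow_norm (by positivity) hp', ENNReal.toReal_ofReal (by positivity),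
    one_div]

lemma eLpNorm_le_weightedSobolevNorm {p : ℝ≥0∞} (hp : 1 ≤ p) {U : Set (EuclideanSpace ℝ (Fin n))}
    {w : EuclideanSpace ℝ (Fin n) → ℝ} {h : EuclideanSpace ℝ (Fin n) → ℝ}
    {g : EuclideanSpace ℝ (Fin n) → EuclideanSpace ℝ (Fin n)}
    (hh : MemLp h p (weightedMeasure w U)) (hg : MemLp g p (weightedMeasure w U)) :
    (eLpNorm h p (weightedMeasure w U)).toReal ≤ weightedSobolevNorm p U w h g ∧
      (eLpNorm g p (weightedMeasure w U)).toReal ≤ weightedSobolevNorm p U w h g := by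
  rcases eq_or_ne p ⊤ with rfl | hp'
  · rw [weightedSobolevNorm, if_pos rfl]
    exact ⟨le_max_left _ _, le_max_right _ _⟩
  · have hp0 : p ≠ 0 := (one_pos.trans_le hp).ne'
    have i1 := hh.integrable_norm_rpow hp0 hp'
    have i2 := hg.integrable_norm_rpow hp0 hp'
    rw [weightedSobolevNorm, if_neg hp', eLpNorm_toReal_eq hp hp' hh, eLpNorm_toReal_eq hp hp' hg]
    have hadd := integral_add i1 i2
    simp only [Real.norm_eq_abs] at hadd ⊢
    have p1 : 0 ≤ ∫ x, |h x| ^ p.toReal ∂weightedMeasure w U := by positivity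
    have p2 : 0 ≤ ∫ x, ‖g x‖ ^ p.toReal ∂weightedMeasure w U := by positivity
    rw [hadd]
    constructor
    · exact Real.rpow_le_rpow p1 (by linarith) (by positivity)
    · exact Real.rpow_le_rpow p2 (by linarith) (by positivity)

lemma weightedMeasure_mono {w : EuclideanSpace ℝ (Fin n) → ℝ}
    {U U' : Set (EuclideanSpace ℝ (Fin n))} (hU : MeasurableSet U) (hU' : MeasurableSet U')
    (h : U ⊆ U') : weightedMeasure w U ≤ weightedMeasure w U' := by
  rw [weightedMeasure, weightedMeasure, ← restrict_withDensity hU, ← restrict_withDensity hU']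
  exact Measure.restrict_mono h le_rfl

lemma weightedMeasure_univ_le {w : EuclideanSpace ℝ (Fin n) → ℝ} (hw : ∀ x, w x ≤ 1)
    (U : Set (EuclideanSpace ℝ (Fin n))) : weightedMeasure w U univ ≤ volume U := by
  rw [weightedMeasure, withDensity_apply _ MeasurableSet.univ, Measure.restrict_univ]
  calc ∫⁻ x in U, ENNReal.ofReal (w x) ≤ ∫⁻ _ in U, 1 :=
        lintegral_mono fun x => ENNReal.ofReal_le_one.2 (hw x)
    _ = volume U := by simp

lemma integrable_weightedMeasure_iff {w : EuclideanSpace ℝ (Fin n) → ℝ} (hw : Measurable w)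
    (hw0 : ∀ x, 0 ≤ w x) (U : Set (EuclideanSpace ℝ (Fin n))) {f : EuclideanSpace ℝ (Fin n) → ℝ} :
    Integrable f (weightedMeasure w U) ↔ IntegrableOn (fun x => f x * w x) U := by
  rw [weightedMeasure, integrable_withDensity_iff_integrable_smul' hw.ennreal_ofReal
    (Filter.Eventually.of_forall fun x => ENNReal.ofReal_lt_top)]
  simp only [ENNReal.toReal_ofReal (hw0 _), smul_eq_mul, mul_comm (w _)]
  rfl

lemma integral_weightedMeasure {w : EuclideanSpace ℝ (Fin n) → ℝ} (hw : Measurable w)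
    (hw0 : ∀ x, 0 ≤ w x) (U : Set (EuclideanSpace ℝ (Fin n))) (f : EuclideanSpace ℝ (Fin n) → ℝ) :
    ∫ x, f x ∂(weightedMeasure w U) = ∫ x in U, f x * w x := by
  rw [weightedMeasure, integral_withDensity_eq_integral_toReal_smul hw.ennreal_ofReal
    (Filter.Eventually.of_forall fun x => ENNReal.ofReal_lt_top)]
  simp only [ENNReal.toReal_ofReal (hw0 _), smul_eq_mul, mul_comm (w _)]

lemma isOpen_sublevel (t : ℝ) : IsOpen (sublevel D t) :=
  isOpen_lt continuous_orientedDist continuous_const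

lemma isOpen_tube (ε : ℝ) : IsOpen (tube D ε) :=
  (isOpen_sublevel ε).sdiff isClosed_closure

lemma abs_lt_subset_tube (ε : ℝ) : {x | |orientedDist D x| < ε} ⊆ tube D ε := by
  intro x hx
  have hx' := abs_lt.1 (show |orientedDist D x| < ε from hx)
  refine ⟨hx'.2, fun hc => ?_⟩
  have : closure (sublevel D (-ε)) ⊆ {x | orientedDist D x ≤ -ε} :=
    closure_minimal (fun y (hy : orientedDist D y < -ε) => show _ ≤ _ from hy.le) (isClosed_le continuous_orientedDist continuous_const)
  have h1 : orientedDist D x ≤ -ε := this hc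
  linarith [hx'.1]

/-- The tube can contain points with d = -ε, when they are not limits of D_{-ε}; doubling the width
absorbs them. -/
lemma tube_subset_abs_lt {ε : ℝ} (hε : 0 < ε) :
    tube D ε ⊆ {x | |orientedDist D x| < 2 * ε} := by
  rintro x ⟨h1, h2⟩
  have h1' : orientedDist D x < ε := h1
  have h2' : -ε ≤ orientedDist D x := by
    by_contra! h
    exact h2 (subset_closure h)
  exact show |orientedDist D x| < 2 * ε from abs_lt.2 ⟨by linarith, by linarith⟩

lemma isBounded_sublevel (hb : Bornology.IsBounded D) (hne : D.Nonempty) (t : ℝ) :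
    Bornology.IsBounded (sublevel D t) := by
  refine (hb.union (isCompact_abs_orientedDist_le hb hne t).isBounded).subset fun x hx => ?_
  by_cases hxD : x ∈ D
  · exact Or.inl hxD
  · right
    have hx' : orientedDist D x < t := hx
    rw [mem_ofPred_eq, abs_of_nonneg]
    · exact hx'.le
    · rw [orientedDist_of_notMem hxD]; exact Metric.infDist_nonneg

lemma ne_univ_of_isBounded (hn : 1 ≤ n) (hb : Bornology.IsBounded D) : D ≠ univ := by
  rintro rfl
  have : Nontrivial (EuclideanSpace ℝ (Fin n)) := by
    have : Nonempty (Fin n) := ⟨⟨0, hn⟩⟩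
    infer_instance
  exact NormedSpace.unbounded_univ ℝ (EuclideanSpace ℝ (Fin n)) hb

/-- The error as an integral over the tube. -/
lemma volumeError_eq {S : ℝ → ℝ} {ε : ℝ} (hw : IsProfile (fun t => (1 + S (-t / ε)) / 2) ε)
    (hε : 0 < ε) (hD : IsOpen D) (hne' : D ≠ univ) {Ω : Set (EuclideanSpace ℝ (Fin n))}
    (hΩ : MeasurableSet Ω) (hsub : sublevel D ε ⊆ Ω) {h : EuclideanSpace ℝ (Fin n) → ℝ}
    (hloc : AEStronglyMeasurable h (volume.restrict (sublevel D ε)))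
    (hint : IntegrableOn (fun x => h x * phaseField S D ε x) (sublevel D ε)) :
    IntegrableOn (fun x => h x * phaseField S D ε x) Ω ∧ IntegrableOn h D ∧
      volumeError S D Ω ε h = ∫ x in {x | |orientedDist D x| < ε},
        h x * (phaseField S D ε x - if orientedDist D x < 0 then 1 else 0) := by
  have hUm := (isOpen_sublevel (D := D) ε).measurableSet
  have hout : ∀ x, x ∉ sublevel D ε → phaseField S D ε x = 0 := fun x hx =>
    hw.eq_zero _ (not_lt.1 hx)
  have hDU : D ⊆ sublevel D ε := fun x hx =>
    ((orientedDist_neg_iff hD hne').2 hx).trans hε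
  -- The phase field is at least 1/2 on D, so weighted integrability controls h itself there.
  have hhD : IntegrableOn h D := by
    refine Integrable.mono' ((hint.mono_set hDU).norm.const_mul 2)
      (hloc.mono_measure (Measure.restrict_mono hDU le_rfl)) ?_
    filter_upwards [ae_restrict_mem hD.measurableSet] with x hx
    have h1 : 1 / 2 ≤ phaseField S D ε x := hw.half_le ((orientedDist_neg_iff hD hne').2 hx).le
    rw [norm_mul, Real.norm_of_nonneg (by linarith : 0 ≤ phaseField S D ε x)]
    nlinarith [norm_nonneg (h x)]
  refine ⟨hint.of_forall_sdiff_eq_zero hΩ fun x hx => by rw [hout x hx.2, mul_zero], hhD, ?_⟩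
  have e1 : ∫ x in Ω, h x * phaseField S D ε x = ∫ x in sublevel D ε, h x * phaseField S D ε x :=
    setIntegral_eq_of_subset_of_forall_sdiff_eq_zero hΩ hsub fun x hx => by
      rw [hout x hx.2, mul_zero]
  have hind : ∀ x, h x * (if orientedDist D x < 0 then 1 else 0) = D.indicator h x := fun x => by
    by_cases hx : x ∈ D
    · rw [if_pos ((orientedDist_neg_iff hD hne').2 hx), indicator_of_mem hx, mul_one]
    · rw [if_neg (mt (orientedDist_neg_iff hD hne').1 hx), indicator_of_notMem hx, mul_zero]
  have e2 : ∫ x in D, h x = ∫ x in sublevel D ε, D.indicator h x := by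
    rw [setIntegral_indicator hD.measurableSet, inter_eq_right.2 hDU]
  rw [volumeError, e1, e2, ← integral_sub hint
    (((integrable_indicator_iff hD.measurableSet).2 hhD).integrableOn)]
  rw [← setIntegral_eq_of_subset_of_forall_sdiff_eq_zero (s := {x | |orientedDist D x| < ε}) hUm
    (fun x hx => show orientedDist D x < ε from (abs_lt.1 hx).2)]
  · refine integral_congr_ae (Filter.Eventually.of_forall fun x => ?_)
    beta_reduce
    rw [mul_sub, hind]
  · rintro x ⟨hx1, hx2⟩
    have hx1' : orientedDist D x < ε := hx1
    have hx3 : orientedDist D x ≤ -ε := by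
      by_contra! hc
      exact hx2 (abs_lt.2 ⟨hc, hx1'⟩)
    have h1 : phaseField S D ε x = 1 := hw.eq_one hx3
    rw [h1, if_pos (by linarith), sub_self, mul_zero]

end DiffuseDomain

/-! ### Assembly of the theorem. -/

open DiffuseDomain in
theorem mainTheorem9 (n : ℕ) (hn : 1 ≤ n)
    (D : Set (EuclideanSpace ℝ (Fin n))) (hD_open : IsOpen D) (hD_conn : IsConnected D)
    (hD_bdd : Bornology.IsBounded D) (hD_bdry : DiffuseDomain.HasC11Boundary D)
    (S : ℝ → ℝ) (hS : DiffuseDomain.IsSigmoidal S)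
    (p : ℝ≥0∞) (hp : 1 ≤ p) (ε₀ : ℝ) (hε₀ : 0 < ε₀) :
    ∃ C : ℝ, 0 < C ∧
      ∀ ε : ℝ, 0 < ε → ε ≤ ε₀ →
      ∀ Ω : Set (EuclideanSpace ℝ (Fin n)), IsOpen Ω → IsConnected Ω → closure D ⊆ Ω →
        DiffuseDomain.sublevel D ε ⊆ Ω →
      ∀ (h : EuclideanSpace ℝ (Fin n) → ℝ)
        (g : EuclideanSpace ℝ (Fin n) → EuclideanSpace ℝ (Fin n)),
        DiffuseDomain.MemWeightedSobolev p (DiffuseDomain.sublevel D ε)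
          (DiffuseDomain.phaseField S D ε) h g →
        IntegrableOn (fun x => h x * DiffuseDomain.phaseField S D ε x) Ω ∧
        IntegrableOn h D ∧
        |DiffuseDomain.volumeError S D Ω ε h| ≤
          C * ε ^ (2 - (1 / p).toReal) *
            DiffuseDomain.weightedSobolevNorm p (DiffuseDomain.tube D ε)
              (DiffuseDomain.phaseField S D ε) h g := by
  have hne := hD_conn.nonempty
  have hne' : D ≠ univ := ne_univ_of_isBounded hn hD_bdd
  obtain ⟨δ, L, V, hδ, hV1, hV2, hV3⟩ := exists_normal_field hD_open hD_bdd hne hne' hD_bdry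
  have hV : IsNormalField D δ L V := ⟨hV1, hV2, fun x hx => (hV3 x hx).1, fun x hx => (hV3 x hx).2⟩
  -- The radius goes up to 2ε₀ because the tube of width ε lies in {|d| < 2ε}.
  obtain ⟨M, hM, hvol⟩ := hV.exists_volume_tube_le hD_bdd hne hδ (2 * ε₀)
  set e : ℝ := 1 - (1 / p).toReal with he
  -- The part 1 + nL comes from the main estimate when ε ≤ δ, the part 1/δ from the trivial bound I
  -- ≤ (ε/δ) I when ε > δ.
  set B : ℝ := 1 + n * L + 1 / δ with hB
  have hB0 : 0 < B := by positivity
  -- The factor 2 counts the contributions of h and of its gradient, each bounded by the full norm;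
  -- (2M)^e comes from Hölder's inequality on a tube of measure at most 2Mε.
  refine ⟨2 * B * (2 * M) ^ e, by positivity, fun ε hε hεε₀ Ω hΩ _ _ hsub h g hmem => ?_⟩
  have hw := hS.isProfile hε
  set w : ℝ → ℝ := fun t => (1 + S (-t / ε)) / 2
  set θ := phaseField S D ε with hθ
  have hθw : ∀ x, θ x = w (orientedDist D x) := fun x => rfl
  have hθm : Measurable θ := (hw.continuous.comp continuous_orientedDist).measurable
  have hθ0 : ∀ x, 0 ≤ θ x := fun x => hw.nonneg _
  have hθ1 : ∀ x, θ x ≤ 1 := fun x => hw.le_one _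
  set U := sublevel D ε with hU
  set T := tube D ε with hT
  have hUm : MeasurableSet U := (isOpen_sublevel ε).measurableSet
  have hTm : MeasurableSet T := (isOpen_tube ε).measurableSet
  have hTU : T ⊆ U := sdiff_subset
  have hfin : IsFiniteMeasure (weightedMeasure θ U) :=
    ⟨(weightedMeasure_univ_le hθ1 U).trans_lt
      (isBounded_sublevel hD_bdd hne ε).measure_lt_top⟩
  have hint : ∀ {f : EuclideanSpace ℝ (Fin n) → ℝ}, MemLp f p (weightedMeasure θ U) →
      IntegrableOn (fun x => f x * θ x) U := fun hf =>
    (integrable_weightedMeasure_iff hθm hθ0 U).1 (hf.integrable hp)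
  obtain ⟨r1, r2, r3⟩ := volumeError_eq hw hε hD_open hne' hΩ.measurableSet hsub
    hmem.isWeakGradient.locallyIntegrable.aestronglyMeasurable (hint hmem.memLp)
  refine ⟨r1, r2, ?_⟩
  rw [r3]
  have hAT := abs_lt_subset_tube (D := D) ε
  have hih := hint hmem.memLp.norm
  have hig := hint hmem.memLp_grad.norm
  have hAU := hAT.trans hTU
  set N := weightedSobolevNorm p T θ h g with hN
  set I := ∫ x in {x | |orientedDist D x| < ε}, (|h x| * θ x + ‖g x‖ * θ x) with hI
  have hIh : ∫ x in {x | |orientedDist D x| < ε}, |h x| * θ x ≤ I := by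
    refine integral_mono (hih.mono_set hAU) ((hih.mono_set hAU).add (hig.mono_set hAU)) fun x => ?_
    have := mul_nonneg (norm_nonneg (g x)) (hθ0 x)
    beta_reduce
    linarith
  have hI0 : 0 ≤ I := integral_nonneg fun x =>
    add_nonneg (mul_nonneg (abs_nonneg _) (hθ0 x)) (mul_nonneg (norm_nonneg _) (hθ0 x))
  have hmain : |∫ x in {x | |orientedDist D x| < ε},
      h x * (θ x - if orientedDist D x < 0 then 1 else 0)| ≤ B * ε * I := by
    rcases le_or_gt ε δ with hle | hlt
    · refine (hV.abs_integral_profile_sub_le hD_bdd hne hw hε hle hmem.isWeakGradient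
        (hih.mono_set hAU) (hig.mono_set hAU)).trans ?_
      have : 0 ≤ 1 / δ * ε * I := by positivity
      calc ε * (1 + n * L) * I ≤ ε * (1 + n * L) * I + 1 / δ * ε * I := by linarith
        _ = B * ε * I := by rw [hB]; ring
    · have h1 : |∫ x in {x | |orientedDist D x| < ε},
          h x * (θ x - if orientedDist D x < 0 then 1 else 0)| ≤ I := by
        refine le_trans ((Real.norm_eq_abs _).symm.le.trans (norm_integral_le_of_norm_le
          (hih.mono_set hAU) (Filter.Eventually.of_forall fun x => ?_))) hIh
        rw [norm_mul]
        exact mul_le_mul_of_nonneg_left (hw.abs_sub_le _) (norm_nonneg _)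
      have h2 : 1 ≤ B * ε := by
        have h3 : 1 ≤ 1 / δ * ε := by
          rw [one_div_mul_eq_div, one_le_div hδ]; exact hlt.le
        have h4 : 0 ≤ (1 + n * L) * ε := by positivity
        rw [hB, add_mul]
        linarith
      nlinarith
  have hTvol : weightedMeasure θ T univ ≤ ENNReal.ofReal (2 * M * ε) := by
    refine (weightedMeasure_univ_le hθ1 T).trans ((measure_mono (tube_subset_abs_lt hε)).trans ?_)
    rw [← ENNReal.ofReal_toReal (volume_abs_orientedDist_lt_ne_top hD_bdd hne (2 * ε))]
    refine ENNReal.ofReal_le_ofReal ((hvol (2 * ε) (by positivity) (by linarith)).trans ?_)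
    linarith
  have hmono := weightedMeasure_mono (w := θ) hTm hUm hTU
  have hhT := hmem.memLp.mono_measure hmono
  have hgT := hmem.memLp_grad.mono_measure hmono
  obtain ⟨n1, n2⟩ := eLpNorm_le_weightedSobolevNorm hp hhT hgT
  have hm0 : 0 ≤ 2 * M * ε := by positivity
  have k1 := integral_norm_le_eLpNorm_mul_rpow hp hhT hm0 hTvol
  have k2 := integral_norm_le_eLpNorm_mul_rpow hp hgT hm0 hTvol
  rw [integral_weightedMeasure hθm hθ0] at k1 k2
  have hIN : I ≤ 2 * N * (2 * M * ε) ^ e := by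
    have i1 : I ≤ ∫ x in T, (‖h x‖ * θ x + ‖g x‖ * θ x) := by
      refine setIntegral_mono_set ((hih.mono_set hTU).add (hig.mono_set hTU))
        (Filter.Eventually.of_forall fun x => ?_) (Filter.Eventually.of_forall hAT)
      exact add_nonneg (mul_nonneg (abs_nonneg _) (hθ0 x)) (mul_nonneg (norm_nonneg _) (hθ0 x))
    rw [integral_add (hih.mono_set hTU) (hig.mono_set hTU)] at i1
    have hpow : 0 ≤ (2 * M * ε) ^ e := by positivity
    have j1 := mul_le_mul_of_nonneg_right n1 hpow
    have j2 := mul_le_mul_of_nonneg_right n2 hpow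
    linarith
  have hexp : ε ^ (2 - (1 / p).toReal) = ε * ε ^ e := by
    rw [show 2 - (1 / p).toReal = 1 + e by rw [he]; ring, Real.rpow_add hε, Real.rpow_one]
  rw [Real.mul_rpow (by positivity) hε.le] at hIN
  rw [hexp]
  calc _ ≤ B * ε * I := hmain
    _ ≤ B * ε * (2 * N * ((2 * M) ^ e * ε ^ e)) := by gcongr
    _ = _ := by ring
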